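/- Let $n\ge 2$ be an integer. Let $(x_1,x_2,x_3)=(x,y,z)$ be the coordinates on $\mathbb{C}^3$ and $u_\sigma$, $\sigma=(i,j,k)\in\mathbb{Z}_{\ge 0}^3$, the jet coordinates of functions on $\mathbb{C}^3$, $u_\sigma([f]_p)=\partial^\sigma f(p)$. Write $|\sigma|=i+j+k$ and $\sigma!=i!\,j!\,k!$, and let $\frac{d}{dx_i}=\frac{\partial}{\partial x_i}+\sum_\sigma u_{\sigma+1_i}\frac{\partial}{\partial u_\sigma}$ be the total derivatives. Let $\mathcal{E}$ be the infinitely prolonged Euler equation of degree $n$: the set of infinite jets at which $x u_{100}+y u_{010}+z u_{001}-n u_{000}$ and all its iterated total derivatives vanish. Then $\mathcal{E}$ is irreducible; let $\mathcal{F}$ be its field of rational functions. An element of $\mathcal{F}$ has order (at most) $m$ if it is a rational function of the $x_i$ and of the $u_\sigma$ with $|\sigma|\le m$. The group $\mathrm{SL}_3(\mathbb{C})$ acts on jets by $[f]_p\mapsto[f\circ g^{-1}]_{gp}$, and a rational differential $\mathrm{SL}_3$-invariant is an $I\in\mathcal{F}$ with $I\circ g=I$ for all $g\in\mathrm{SL}_3(\mathbb{C})$.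 On $\mathcal{E}$ consider the symmetric tensors $$\Theta_m=\sum_{i+j+k=m}u_{ijk}\,\frac{dx^i}{i!}\frac{dy^j}{j!}\frac{dz^k}{k!},\qquad m\ge 0.$$ Let $H$ be the Hessian matrix of the second-order coordinates $u_\sigma$, $|\sigma|=2$, and let $A=\det H$. Set $$\omega_1=\Theta_1,\qquad \omega_2=\widehat{d}A=\sum_i\frac{dA}{dx_i}\,dx_i,\qquad \omega_3=F_1dx+F_2dy+F_3dz,\quad (F_1,F_2,F_3)^{T}=H(\omega_1\times\omega_2),$$ where in the last formula $\omega_1,\omega_2$ stand for their coefficient vectors and $\times$ is the cross product. **Theorem.** 1. $A$ and the determinant of the coefficients of $\omega_1,\omega_2,\omega_3$ are nonzero in $\mathcal{F}$, and $\omega_3$ satisfies $\Theta_2^{-1}(\omega_1,\omega_3)=\Theta_2^{-1}(\omega_2,\omega_3)=0$. 2. There are unique $I_{ijk}\in\mathcal{F}$ such that for all $m\ge 0$ $$\Theta_m=\sum_{i+j+k=m}I_{ijk}\,\frac{\omega_1^i}{i!}\frac{\omega_2^j}{j!}\frac{\omega_3^k}{k!}.$$ 3. Every $I_{ijk}$ is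 a rational differential $\mathrm{SL}_3$-invariant. It has order $i+j+k$ if $i+j+k\ne 2$, and order $3$ if $i+j+k=2$. 4. The rational differential $\mathrm{SL}_3$-invariants are exactly the rational functions, with complex coefficients, of the $I_{ijk}$: the field of rational differential $\mathrm{SL}_3$-invariants equals $\mathbb{C}(I_{ijk}: i,j,k\ge 0)$. -/

import Mathlib

open MvPolynomial

namespace TernaryJets

/-! ### Jets of functions on `ℂ³` and the prolonged Euler equation -/

/-- Multi-indices `σ = (i, j, k)`. -/
abbrev MultiIndex : Type := Fin 3 →₀ ℕ

/-- Names of the canonical coordinates on the space of infinite jets of functions on `ℂ³`: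
`Sum.inl i` stands for the base coordinate `x_i` (that is `x`, `y`, `z`), and `Sum.inr σ` for the
jet coordinate `u_σ`, with `u_σ([f]_p) = ∂^σ f (p)`. -/
abbrev JetVar : Type := Fin 3 ⊕ MultiIndex

/-- The space of infinite jets, in canonical coordinates. -/
abbrev Jet : Type := JetVar → ℂ

/-- Polynomial functions on the jet space (each one depends on a jet of finite order). -/
abbrev JetPoly : Type := MvPolynomial JetVar ℂ

/-- The base coordinate `x_i`. -/
noncomputable def xCoord (i : Fin 3) : JetPoly := X (Sum.inl i)

/-- The jet coordinate `u_σ`. -/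
noncomputable def uCoord (s : MultiIndex) : JetPoly := X (Sum.inr s)

/-- The total derivative `d/dx_i = ∂/∂x_i + ∑_σ u_{σ + 1_i} ∂/∂u_σ`. -/
noncomputable def totalDeriv (i : Fin 3) : Derivation ℂ JetPoly JetPoly :=
  mkDerivation ℂ (Sum.elim (fun j => if j = i then 1 else 0)
    (fun s => uCoord (s + Finsupp.single i 1)))

/-- The left hand side minus the right hand side of the Euler equation
`x u_x + y u_y + z u_z = n u`. -/
noncomputable def eulerPoly (n : ℕ) : JetPoly :=
  ∑ i, xCoord i * uCoord (Finsupp.single i 1) - C (n : ℂ) * uCoord 0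

/-- The infinitely prolonged Euler equation: the common zeros of all the iterated total derivatives
of the Euler equation. -/
def eulerEquation (n : ℕ) : Set Jet :=
  {θ | ∀ l : List (Fin 3), eval θ (l.foldr (fun i P => totalDeriv i P) (eulerPoly n)) = 0}

/-! ### The prolonged Euler equation is irreducible -/

lemma foldr_eulerPoly (n : ℕ) (l : List (Fin 3)) :
    l.foldr (fun i P => totalDeriv i P) (eulerPoly n) =
      ∑ i, xCoord i * uCoord ((l.map fun j => Finsupp.single j 1).sum + Finsupp.single i 1)
        - C ((n : ℂ) - (l.length : ℂ)) * uCoord ((l.map fun j => Finsupp.single j 1).sum) := by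
  induction l with
  | nil => simp [eulerPoly]
  | cons j l ih =>
    simp only [List.foldr_cons, ih, List.map_cons, List.sum_cons, List.length_cons]
    generalize (l.map fun j => (Finsupp.single j 1 : MultiIndex)).sum = s
    have hx : ∀ i, totalDeriv j (xCoord i) = if i = j then 1 else 0 := fun i => by
      simp [totalDeriv, xCoord, mkDerivation_X]
    have hu : ∀ t, totalDeriv j (uCoord t) = uCoord (t + Finsupp.single j 1) := fun t => by
      simp [totalDeriv, uCoord, mkDerivation_X]
    have hC : ∀ c : ℂ, totalDeriv j (C c) = 0 := fun c => (totalDeriv j).map_algebraMap c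
    have e : ∀ i, s + Finsupp.single i 1 + Finsupp.single j 1
        = Finsupp.single j 1 + s + Finsupp.single i 1 := fun i => by abel
    simp only [map_sub, map_sum, Derivation.leibniz, hx, hu, hC, smul_eq_mul, mul_zero,
      e, Finset.sum_add_distrib, mul_ite, mul_one, Finset.sum_ite_eq', Finset.mem_univ, if_true,
      add_comm s (Finsupp.single j 1)]
    simp only [Nat.cast_add, Nat.cast_one, map_add, map_one]
    ring

lemma mem_eulerEquation {n : ℕ} {θ : Jet} : θ ∈ eulerEquation n ↔
    ∀ s : MultiIndex, ∑ i, θ (Sum.inl i) * θ (Sum.inr (s + Finsupp.single i 1)) =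
      ((n : ℂ) - (s.degree : ℂ)) * θ (Sum.inr s) := by
  have hdeg : ∀ l : List (Fin 3),
      Finsupp.degree (l.map fun j => (Finsupp.single j 1 : MultiIndex)).sum = l.length := by
    intro l
    induction l with
    | nil => simp
    | cons j l ih => simp [map_add, ih, add_comm]
  have hsurj : ∀ s : MultiIndex, ∃ l : List (Fin 3),
      (l.map fun j => (Finsupp.single j 1 : MultiIndex)).sum = s := by
    intro s
    induction s using Finsupp.induction_linear with
    | zero => exact ⟨[], rfl⟩
    | add f g hf hg =>
      obtain ⟨a, ha⟩ := hf
      obtain ⟨b, hb⟩ := hg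
      exact ⟨a ++ b, by simp [ha, hb]⟩
    | single a b => exact ⟨List.replicate b a, by simp⟩
  have key : ∀ l : List (Fin 3),
      eval θ (l.foldr (fun i P => totalDeriv i P) (eulerPoly n)) =
      ∑ i, θ (Sum.inl i) *
          θ (Sum.inr ((l.map fun j => Finsupp.single j 1).sum + Finsupp.single i 1))
        - ((n : ℂ) - ((Finsupp.degree (l.map fun j => (Finsupp.single j 1 : MultiIndex)).sum : ℕ) : ℂ)) *
          θ (Sum.inr (l.map fun j => Finsupp.single j 1).sum) := by
    intro l
    rw [foldr_eulerPoly, hdeg]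
    simp [xCoord, uCoord, map_sum]
  constructor
  · intro h s
    obtain ⟨l, rfl⟩ := hsurj s
    exact sub_eq_zero.1 ((key l).symm.trans (h l))
  · intro h l
    rw [key l, sub_eq_zero]
    exact h _

/-- On the prolonged Euler equation, `x_i ^ m * u_{r + m 1_i}` as a polynomial in the
`x_j` and in the `u_{r'}` with `r' i = r i`. -/
noncomputable def chart {R : Type*} [CommRing R] (n : ℕ) (i : Fin 3) (x : Fin 3 → R) (w : MultiIndex → R) :
    ℕ → MultiIndex → R
  | 0, r => w r
  | m + 1, r => ((n : R) - (r.degree : R) - (m : R)) * chart n i x w m r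
      - ∑ j ∈ Finset.univ.erase i, x j * chart n i x w m (r + Finsupp.single j 1)

lemma map_chart {R S : Type*} [CommRing R] [CommRing S] (f : R →+* S) (n : ℕ) (i : Fin 3)
    (x : Fin 3 → R) (w : MultiIndex → R) (m : ℕ) (r : MultiIndex) :
    f (chart n i x w m r) = chart n i (fun j => f (x j)) (fun s => f (w s)) m r := by
  induction m generalizing r with
  | zero => rfl
  | succ m ih => simp [chart, ih, map_sum]

lemma chart_eq {n : ℕ} {θ : Jet} (h : θ ∈ eulerEquation n) (i : Fin 3) (m : ℕ) (r : MultiIndex) :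
    θ (Sum.inl i) ^ m * θ (Sum.inr (r + Finsupp.single i m)) =
      chart n i (fun j => θ (Sum.inl j)) (fun s => θ (Sum.inr s)) m r := by
  induction m generalizing r with
  | zero => simp [chart]
  | succ m ih =>
    have h1 := mem_eulerEquation.1 h (r + Finsupp.single i m)
    rw [← Finset.add_sum_erase _ _ (Finset.mem_univ i)] at h1
    simp only [chart, ← ih]
    have e1 : r + Finsupp.single i m + Finsupp.single i 1 = r + Finsupp.single i (m + 1) := by
      rw [add_assoc, ← Finsupp.single_add]
    have e2 : ∀ j, r + Finsupp.single i m + Finsupp.single j 1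
        = r + Finsupp.single j 1 + Finsupp.single i m := fun j => by abel
    simp only [e1, e2, map_add, Finsupp.degree_single, Nat.cast_add] at h1
    rw [pow_succ, mul_assoc, eq_sub_of_add_eq h1, mul_sub, Finset.mul_sum]
    congr 1
    · ring
    · exact Finset.sum_congr rfl fun j _ => by ring

/-- The point of the prolonged Euler equation over `x` (with `x i ≠ 0`) with
prescribed `u_r`, `r i = 0`. -/
noncomputable def chartPoint (n : ℕ) (i : Fin 3) (x : Fin 3 → ℂ) (w : MultiIndex → ℂ) : Jet :=
  Sum.elim x (fun s => (x i ^ s i)⁻¹ * chart n i x w (s i) (s.erase i))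

lemma chartPoint_mem (n : ℕ) (i : Fin 3) (x : Fin 3 → ℂ) (w : MultiIndex → ℂ) (hx : x i ≠ 0) :
    chartPoint n i x w ∈ eulerEquation n := by
  rw [mem_eulerEquation]
  intro s
  have hs : (s.degree : ℂ) = ((s.erase i).degree : ℂ) + (s i : ℂ) := by
    conv_lhs => rw [← Finsupp.erase_add_single i s]
    simp [map_add]
  have e1 : (s + Finsupp.single i 1).erase i = s.erase i := by
    rw [Finsupp.erase_add, Finsupp.erase_single, add_zero]
  have e2 : ∀ j, j ≠ i → (s + Finsupp.single j 1).erase i = s.erase i + Finsupp.single j 1 :=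
    fun j hj => by rw [Finsupp.erase_add, Finsupp.erase_single_ne hj.symm]
  have e3 : ∀ j, j ≠ i → (s + Finsupp.single j 1 : MultiIndex) i = s i := fun j hj => by
    simp [Finsupp.single_eq_of_ne hj.symm]
  rw [← Finset.add_sum_erase _ _ (Finset.mem_univ i)]
  have : ∑ j ∈ Finset.univ.erase i, chartPoint n i x w (Sum.inl j) *
      chartPoint n i x w (Sum.inr (s + Finsupp.single j 1)) = (x i ^ s i)⁻¹ *
      ∑ j ∈ Finset.univ.erase i, x j * chart n i x w (s i) (s.erase i + Finsupp.single j 1) := by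
    rw [Finset.mul_sum]
    refine Finset.sum_congr rfl fun j hj => ?_
    have hj' := (Finset.mem_erase.1 hj).1
    simp only [chartPoint, Sum.elim_inl, Sum.elim_inr, e2 j hj', e3 j hj']
    ring
  rw [this]
  simp only [chartPoint, Sum.elim_inl, Sum.elim_inr, e1, Finsupp.add_apply,
    Finsupp.single_eq_same, chart, hs]
  have hp : x i ^ s i ≠ 0 := pow_ne_zero _ hx
  field_simp
  ring

lemma eq_chartPoint {n : ℕ} {θ : Jet} (h : θ ∈ eulerEquation n) (i : Fin 3)
    (hx : θ (Sum.inl i) ≠ 0) :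
    chartPoint n i (fun j => θ (Sum.inl j)) (fun s => θ (Sum.inr s)) = θ := by
  funext v
  cases v with
  | inl j => rfl
  | inr s =>
    simp only [chartPoint, Sum.elim_inr, ← chart_eq h, Finsupp.erase_add_single]
    field_simp

lemma exists_numerator (n : ℕ) (P : JetPoly) : ∃ (N : ℕ) (p : JetPoly), ∀ θ : Jet,
    θ (Sum.inl 0) ≠ 0 → eval θ p = θ (Sum.inl 0) ^ N *
      eval (chartPoint n 0 (fun j => θ (Sum.inl j)) (fun s => θ (Sum.inr s))) P := by
  induction P using MvPolynomial.induction_on with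
  | C a => exact ⟨0, C a, fun θ _ => by simp⟩
  | add P Q hP hQ =>
    obtain ⟨N, p, hp⟩ := hP
    obtain ⟨M, q, hq⟩ := hQ
    refine ⟨N + M, xCoord 0 ^ M * p + xCoord 0 ^ N * q, fun θ h => ?_⟩
    simp only [map_add, map_mul, map_pow, hp θ h, hq θ h, xCoord, eval_X]
    ring
  | mul_X P v hP =>
    obtain ⟨N, p, hp⟩ := hP
    cases v with
    | inl j =>
      refine ⟨N, p * xCoord j, fun θ h => ?_⟩
      simp only [map_mul, hp θ h, xCoord, eval_X, chartPoint, Sum.elim_inl]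
      ring
    | inr s =>
      refine ⟨N + s 0, p * chart n 0 xCoord uCoord (s 0) (s.erase 0), fun θ h => ?_⟩
      rw [map_mul, map_chart, map_mul, hp θ h, eval_X]
      simp only [xCoord, uCoord, eval_X]
      have hp' : θ (Sum.inl 0) ^ s 0 ≠ 0 := pow_ne_zero _ h
      have hv : eval (chartPoint n 0 (fun j => θ (Sum.inl j)) (fun s => θ (Sum.inr s)))
          (X (Sum.inr s)) = (θ (Sum.inl 0) ^ s 0)⁻¹ *
            chart n 0 (fun j => θ (Sum.inl j)) (fun s => θ (Sum.inr s)) (s 0) (s.erase 0) := by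
        simp [chartPoint]
      rw [eval_X] at hv
      rw [hv, pow_add]
      field_simp

lemma exists_curve {n : ℕ} {θ : Jet} (h : θ ∈ eulerEquation n) (h0 : θ (Sum.inl 0) = 0) :
    ∃ γ : JetVar → Polynomial ℂ, (fun v => (γ v).eval 0) = θ ∧
      ∀ t : ℂ, t ≠ 0 → (fun v => (γ v).eval t) ∈ eulerEquation n ∧ (γ (Sum.inl 0)).eval t ≠ 0 := by
  by_cases hx : ∃ i, θ (Sum.inl i) ≠ 0
  · obtain ⟨i, hi⟩ := hx
    have hi0 : i ≠ 0 := by rintro rfl; exact hi h0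
    set xs : Fin 3 → Polynomial ℂ :=
      fun j => if j = 0 then Polynomial.X else Polynomial.C (θ (Sum.inl j)) with hxs
    let γ : JetVar → Polynomial ℂ := Sum.elim xs
      (fun s => Polynomial.C ((θ (Sum.inl i) ^ s i)⁻¹) *
        chart n i xs (fun r => Polynomial.C (θ (Sum.inr r))) (s i) (s.erase i))
    have hγ : ∀ t : ℂ, (fun v => (γ v).eval t) =
        chartPoint n i (fun j => (xs j).eval t) (fun s => θ (Sum.inr s)) := by
      intro t
      funext v
      cases v with
      | inl j => rfl
      | inr s =>
        have := map_chart (Polynomial.evalRingHom t) n i xs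
          (fun r => Polynomial.C (θ (Sum.inr r))) (s i) (s.erase i)
        simp only [Polynomial.coe_evalRingHom, Polynomial.eval_C] at this
        simp only [γ, chartPoint, Sum.elim_inr, Polynomial.eval_mul, Polynomial.eval_C, this]
        simp [hxs, hi0]
    refine ⟨γ, ?_, fun t ht => ⟨?_, ?_⟩⟩
    · rw [hγ]
      have : (fun j => (xs j).eval 0) = fun j => θ (Sum.inl j) := by
        funext j
        by_cases hj : j = 0
        · subst hj; simp [hxs, h0]
        · simp [hxs, hj]
      rw [this]
      exact eq_chartPoint h i hi
    · rw [hγ]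
      exact chartPoint_mem n i _ _ (by simp [hxs, hi0, hi])
    · simp [γ, hxs, ht]
  · push Not at hx
    have hu : ∀ s : MultiIndex, s.degree ≠ n → θ (Sum.inr s) = 0 := by
      intro s hs
      have h1 := mem_eulerEquation.1 h s
      simp only [hx, zero_mul, Finset.sum_const_zero] at h1
      refine (mul_eq_zero.1 h1.symm).resolve_left ?_
      rw [sub_eq_zero]
      exact_mod_cast hs.symm
    let γ : JetVar → Polynomial ℂ := Sum.elim
      (fun j => if j = 0 then Polynomial.X else 0)
      (fun s => if s.degree ≤ n then
        Polynomial.C (θ (Sum.inr (s + Finsupp.single 0 (n - s.degree))) /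
          (Nat.factorial (n - s.degree) : ℂ)) * Polynomial.X ^ (n - s.degree) else 0)
    refine ⟨γ, ?_, fun t ht => ⟨?_, by simp [γ, ht]⟩⟩
    · funext v
      cases v with
      | inl j => by_cases hj : j = 0 <;> simp [γ, hj, hx]
      | inr s =>
        rcases lt_trichotomy s.degree n with hs | hs | hs
        · simp [γ, hs.le, hu s hs.ne, Nat.sub_ne_zero_of_lt hs]
        · simp [γ, hs]
        · simp [γ, hu s hs.ne', not_le.2 hs]
    · rw [mem_eulerEquation]
      intro s
      have hsum : ∀ g : Fin 3 → ℂ, ∑ i, (γ (Sum.inl i)).eval t * g i = t * g 0 := by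
        intro g
        simp [γ, Fin.sum_univ_three]
      rw [hsum]
      rcases lt_trichotomy s.degree n with hs | hs | hs
      · obtain ⟨m, hm⟩ := Nat.exists_eq_add_of_lt hs
        have a1 : n - s.degree = m + 1 := by omega
        have a2 : n - (s.degree + 1) = m := by omega
        have a3 : s.degree + 1 ≤ n := by omega
        have a4 : (n : ℂ) - (s.degree : ℂ) = (m : ℂ) + 1 := by
          rw [hm]; push_cast; ring
        have a5 : s + Finsupp.single 0 1 + Finsupp.single 0 m = s + Finsupp.single 0 (m + 1) := by
          rw [add_assoc, ← Finsupp.single_add, add_comm 1 m]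
        have hf : (Nat.factorial m : ℂ) ≠ 0 := by exact_mod_cast Nat.factorial_ne_zero m
        have hm1 : (m : ℂ) + 1 ≠ 0 := by exact_mod_cast Nat.succ_ne_zero m
        simp only [γ, Sum.elim_inr, map_add, Finsupp.degree_single, a1, a2, a3, a4, a5, hs.le,
          if_true, Polynomial.eval_mul, Polynomial.eval_C, Polynomial.eval_pow, Polynomial.eval_X,
          Nat.factorial_succ, Nat.cast_mul, Nat.cast_add, Nat.cast_one]
        field_simp
        ring
      · simp [γ, map_add, hs]
      · have b1 : ¬ s.degree ≤ n := by omega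
        have b2 : ¬ s.degree + 1 ≤ n := by omega
        simp [γ, map_add, b1, b2]

lemma vanish_of_chart {n : ℕ} {P : JetPoly}
    (hP : ∀ θ ∈ eulerEquation n, θ (Sum.inl 0) ≠ 0 → eval θ P = 0) :
    ∀ θ ∈ eulerEquation n, eval θ P = 0 := by
  intro θ h
  by_cases h0 : θ (Sum.inl 0) = 0
  · obtain ⟨γ, rfl, hγ⟩ := exists_curve h h0
    have hev : ∀ (t : ℂ) (P : JetPoly), (aeval γ P).eval t = eval (fun v => (γ v).eval t) P := by
      intro t P
      induction P using MvPolynomial.induction_on with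
      | C a => simp
      | add p q hp hq => simp [hp, hq]
      | mul_X p v hp => simp [hp]
    have hz : aeval γ P = 0 := by
      refine Polynomial.eq_zero_of_infinite_isRoot _
        (Set.Infinite.mono (s := {0}ᶜ) ?_ (Set.finite_singleton (0 : ℂ)).infinite_compl)
      intro t ht
      exact (hev t P).trans (hP _ (hγ t ht).1 (hγ t ht).2)
    rw [← hev, hz, Polynomial.eval_zero]
  · exact hP θ h h0

instance isPrime_vanishingIdeal (n : ℕ) : (vanishingIdeal ℂ (eulerEquation n)).IsPrime := by
  have hmem : ∀ P : JetPoly, P ∈ vanishingIdeal ℂ (eulerEquation n) ↔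
      ∀ θ ∈ eulerEquation n, eval θ P = 0 := fun P => by
    simp only [mem_vanishingIdeal_iff, ← coe_aeval_eq_eval, RingHom.coe_coe]
  refine ⟨fun h => ?_, fun {P Q} h => ?_⟩
  · have h1 := (hmem 1).1 (h ▸ Submodule.mem_top) 0 (mem_eulerEquation.2 (by simp))
    simp at h1
  · obtain ⟨N, p, hp⟩ := exists_numerator n P
    obtain ⟨M, q, hq⟩ := exists_numerator n Q
    have hchart : ∀ (R p : JetPoly) (N : ℕ), (∀ θ : Jet,
        θ (Sum.inl 0) ≠ 0 → eval θ p = θ (Sum.inl 0) ^ N *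
        eval (chartPoint n 0 (fun j => θ (Sum.inl j)) (fun s => θ (Sum.inr s))) R) →
        p = 0 → R ∈ vanishingIdeal ℂ (eulerEquation n) := by
      intro R p N hR hp0
      refine (hmem R).2 (vanish_of_chart fun θ hθ h0 => ?_)
      have h1 := hR θ h0
      rw [eq_chartPoint hθ 0 h0, hp0, map_zero] at h1
      exact (mul_eq_zero.1 h1.symm).resolve_left (pow_ne_zero _ h0)
    have hz : xCoord 0 * (p * q) = 0 := by
      refine MvPolynomial.funext fun θ => ?_
      by_cases h0 : θ (Sum.inl 0) = 0
      · simp [xCoord, h0]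
      · have h1 := (hmem _).1 h _
          (chartPoint_mem n 0 (fun j => θ (Sum.inl j)) (fun s => θ (Sum.inr s)) h0)
        rw [map_mul] at h1
        rw [map_mul, map_mul, hp θ h0, hq θ h0, map_zero]
        linear_combination θ (Sum.inl 0) ^ (N + M) * eval θ (xCoord 0) * h1
    have hX : xCoord 0 ≠ 0 := X_ne_zero _
    rcases mul_eq_zero.1 ((mul_eq_zero.1 hz).resolve_left hX) with h0 | h0
    · exact Or.inl (hchart P p N hp h0)
    · exact Or.inr (hchart Q q M hq h0)

/-! ### Rational functions on the Euler equation -/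

/-- The field of rational functions on the prolonged Euler equation: the field of
fractions of the ring of polynomial functions on it. -/
abbrev RationalFunction (n : ℕ) : Type :=
  FractionRing (JetPoly ⧸ vanishingIdeal ℂ (eulerEquation n))

/-- The restriction of a polynomial function on the jet space to the Euler equation. -/
noncomputable def restrict (n : ℕ) (P : JetPoly) : RationalFunction n :=
  algebraMap (JetPoly ⧸ vanishingIdeal ℂ (eulerEquation n)) (RationalFunction n)
    (Ideal.Quotient.mk _ P)

/-- The rational functions of order at most `k`, that is those on `k`-jets: the rational functions
of the coordinates `x_i` and `u_σ` with `|σ| ≤ k`. -/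
noncomputable def orderLE (n k : ℕ) : IntermediateField ℂ (RationalFunction n) :=
  IntermediateField.adjoin ℂ
    (Set.range (fun i => restrict n (xCoord i)) ∪
      (fun s => restrict n (uCoord s)) '' {s | s.degree ≤ k})

/-! ### Symmetric tensors and the action of `SL₃` -/

/-- The symmetric tensor `∑_{|σ| = m} c_σ ω^σ / σ!`, where `ω_j = ∑_i B j i dx_i`, as a homogeneous
polynomial in `dx_0, dx_1, dx_2` (the variables). -/
noncomputable def symTensor {K : Type*} [Field K] (c : MultiIndex → K)
    (B : Matrix (Fin 3) (Fin 3) K) (m : ℕ) : MvPolynomial (Fin 3) K :=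
  ∑ s ∈ Finset.finsuppAntidiag Finset.univ m,
    C (c s / ∏ j, (Nat.factorial (s j) : K)) * ∏ j, (∑ i, C (B j i) * X i) ^ s j

/-- The action `[f]_p ↦ [f ∘ A⁻¹]_{A p}` of `SL₃(ℂ)` on jets. If `∑_σ u_σ h^σ / σ!` is the Taylor
series of `f` at `p`, that of `f ∘ A⁻¹` at `A p` is obtained from it by substituting `A⁻¹ h`
for `h`, and its `σ`-th jet coordinate is `σ!` times the coefficient of `h^σ`. -/
noncomputable def act (A : Matrix.SpecialLinearGroup (Fin 3) ℂ) (θ : Jet) : Jet :=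
  Sum.elim
    (fun i => ∑ j, A.1 i j * θ (Sum.inl j))
    (fun s => (∏ j, (Nat.factorial (s j) : ℂ)) *
      coeff s (symTensor (fun t => θ (Sum.inr t)) (A⁻¹).1 s.degree))

/-- The rational function `I` on the Euler equation is a rational differential `SL₃`-invariant:
`I ∘ A = I` for all `A`. For `I = P / Q` this is an identity of rational functions,
written here with denominators cleared. -/
def IsDifferentialInvariant {n : ℕ} (I : RationalFunction n) : Prop :=
  ∀ (A : Matrix.SpecialLinearGroup (Fin 3) ℂ) (P Q : JetPoly),
    restrict n Q ≠ 0 → I = restrict n P / restrict n Q →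
      ∀ θ ∈ eulerEquation n, eval (act A θ) P * eval θ Q = eval θ P * eval (act A θ) Q

/-! ### The invariant coframe -/

/-- The Hessian matrix `(u_{1_i + 1_j})`; the quadratic form `Θ₂` has the matrix
`(1 / 2) • hessian`. -/
noncomputable def hessian : Matrix (Fin 3) (Fin 3) JetPoly :=
  Matrix.of fun i j => uCoord (Finsupp.single i 1 + Finsupp.single j 1)

/-- The coefficients of `ω₁ = Θ₁`. -/
noncomputable def omega1 : Fin 3 → JetPoly := fun i => uCoord (Finsupp.single i 1)

/-- The coefficients of `ω₂ = d̂A`, the total differential of `A`, the Hessian determinant. -/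
noncomputable def omega2 : Fin 3 → JetPoly := fun i => totalDeriv i hessian.det

/-- The coefficients of `ω₃`: the product of the Hessian matrix with the cross product of
`ω₁` and `ω₂`. -/
noncomputable def omega3 : Fin 3 → JetPoly :=
  hessian.mulVec (crossProduct omega1 omega2)

/-- The matrix whose rows are the coefficients of `ω₁`, `ω₂`, `ω₃` on the Euler equation. -/
noncomputable def coframe (n : ℕ) : Matrix (Fin 3) (Fin 3) (RationalFunction n) :=
  (Matrix.of ![omega1, omega2, omega3]).map (restrict n)

/-- The matrix of the contravariant tensor `Θ₂⁻¹` on the Euler equation. -/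
noncomputable def theta2Inv (n : ℕ) : Matrix (Fin 3) (Fin 3) (RationalFunction n) :=
  ((1 / 2 : RationalFunction n) • hessian.map (restrict n))⁻¹

/-- The tensor `Θ_m = ∑_{|σ| = m} u_σ dx^σ / σ!` on the Euler equation. -/
noncomputable def theta (n m : ℕ) : MvPolynomial (Fin 3) (RationalFunction n) :=
  symTensor (fun s => restrict n (uCoord s)) 1 m

/-- The functions `I σ = I_{ijk}` are the coefficients of all the tensors `Θ_m` in the coframe
`ω₁, ω₂, ω₃`. -/
def IsExpansion (n : ℕ) (I : MultiIndex → RationalFunction n) : Prop :=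
  ∀ m : ℕ, theta n m = symTensor I (coframe n) m

end TernaryJets

open TernaryJets

/-!
Everything rests on one operation: `substJet c B` transforms the Taylor coefficients `c` of a
function under the linear substitution `h ↦ B h`. It satisfies the chain rule
(`substJet_add_single`), which determines it by recursion on the order, and from which it follows
that it is functorial in `B` (`substJet_substJet`), linear in `c`, and compatible with ring
homomorphisms and derivations. Up to factorials it gives the coefficients of symmetric tensors
(`prod_factorial_mul_coeff_symTensor`), so a family `I` expands all the `Θ_m` in the coframe
`B = (ω₁, ω₂, ω₃)` if and only if `substJet I B = u`, that is `I = substJet u B⁻¹`. This gives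
existence, uniqueness, and the orders. That `det B` is not zero is checked at one jet
(`exists_nondegenerate_jet`).

The group acts on the field of rational functions (`actRat`), and `IsDifferentialInvariant` means
being fixed by it. The total derivatives are equivariant (`actPoly_totalDeriv`), hence so are `ω₁`,
`ω₂`, `ω₃`, where `ω₃` needs matrices of determinant `1` because of the cross product. The `I_σ` are
the coefficients of invariant tensors in an invariant coframe, so they are invariant.

Conversely, let `δ = det B`. The matrix `diag (δ⁻¹, 1, 1) B` has determinant `1`; applied to the jet
itself, it produces a normalized jet. An invariant `P / Q` takes the same value there as at the
original jet, and the coordinates of the normalized jet are rational functions of the `I_σ`: its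
derivatives are the `I_σ` rescaled by powers of `δ`, one has `δ⁻¹ = I₀₀₂`
(`invariantHessian_mul_det_coframe`), and its base point is found from the Euler equation in the
form `H x = (n - 1) ω₁` (`coframe_mulVec_xRat`). If `Q` vanishes on all normalized jets, the
quotient cannot be evaluated there; so the normalized jets are moved by a further constant matrix,
chosen so that one of them is a given jet with `Q ≠ 0` (`mem_invariantField`). To apply the
definition of invariance, which quantifies over constant matrices, to the matrix
`diag (δ⁻¹, 1, 1) B`, which depends on the jet, one works in the ring of the functions `P / δ ^ k`,
where identities can be tested at points (`restrictAway_eq_zero_iff`).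
-/

open MvPolynomial

namespace TernaryJets

/-! ### Linear substitution in jets -/

section Substitution

variable {R : Type*} [CommRing R]

/-- The product `∏ i, (∑ j, B j i X_j) ^ s i`: the monomial `X ^ s` after the substitution
`X ↦ Bᵀ X`. -/
noncomputable def linPow (B : Matrix (Fin 3) (Fin 3) R) (s : MultiIndex) : MvPolynomial (Fin 3) R :=
  ∏ i, (∑ j, C (B j i) * X j) ^ s i

/-- The linear functional on polynomials that sends `X ^ t` to `c t`. -/
noncomputable def contraction (c : MultiIndex → R) : MvPolynomial (Fin 3) R →ₗ[R] R :=
  (basisMonomials (Fin 3) R).constr R c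

/-- The `s`-th derivative at `0` of `h ↦ ∑ t, c t * (B h) ^ t / t!`, written without denominators:
by the chain rule it is the differential operator `∏ i, (∑ j, B j i ∂_j) ^ s i` applied to a
function whose derivatives are the `c t`. -/
noncomputable def substJet (c : MultiIndex → R) (B : Matrix (Fin 3) (Fin 3) R)
    (s : MultiIndex) : R :=
  contraction c (linPow B s)

lemma multiIndex_induction {p : MultiIndex → Prop} (zero : p 0)
    (add_single : ∀ s i, p s → p (s + Finsupp.single i 1)) (s : MultiIndex) : p s := by
  induction s using Finsupp.induction₂ with
  | zero => exact zero
  | add_single a b f _ _ ih =>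
    clear * - add_single ih
    induction b with
    | zero => simpa using ih
    | succ b hb =>
      rw [Finsupp.single_add, ← add_assoc]
      exact add_single _ _ hb

lemma contraction_monomial (c : MultiIndex → R) (t : MultiIndex) (a : R) :
    contraction c (monomial t a) = a * c t := by
  have h : monomial t a = a • (basisMonomials (Fin 3) R) t := by
    simp [smul_monomial]
  rw [h, map_smul, contraction, Module.Basis.constr_basis, smul_eq_mul]

lemma contraction_eq_sum (c : MultiIndex → R) (p : MvPolynomial (Fin 3) R) :
    contraction c p = ∑ t ∈ p.support, coeff t p * c t := by
  conv_lhs => rw [p.as_sum, map_sum]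
  simp only [contraction_monomial]

lemma contraction_mul_X (c : MultiIndex → R) (p : MvPolynomial (Fin 3) R) (j : Fin 3) :
    contraction c (p * X j) = contraction (fun t => c (t + Finsupp.single j 1)) p := by
  induction p using MvPolynomial.induction_on' with
  | monomial t a =>
    rw [X, monomial_mul, mul_one, contraction_monomial, contraction_monomial]
  | add p q hp hq => rw [add_mul, map_add, map_add, hp, hq]

lemma linPow_add_single (B : Matrix (Fin 3) (Fin 3) R) (s : MultiIndex) (i : Fin 3) :
    linPow B (s + Finsupp.single i 1) = linPow B s * ∑ j, C (B j i) * X j := by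
  simp only [linPow, Finsupp.add_apply, pow_add, Finset.prod_mul_distrib]
  congr 1
  rw [Finset.prod_eq_single i (fun j _ hj => by simp [Finsupp.single_eq_of_ne hj])
    (by simp)]
  simp

@[simp] lemma linPow_zero (B : Matrix (Fin 3) (Fin 3) R) : linPow B 0 = 1 := by
  simp [linPow]

lemma linPow_isHomogeneous (B : Matrix (Fin 3) (Fin 3) R) (s : MultiIndex) :
    (linPow B s).IsHomogeneous s.degree := by
  rw [Finsupp.degree_eq_sum]
  refine IsHomogeneous.prod _ _ _ fun i _ => ?_
  have h : (∑ j, C (B j i) * X j : MvPolynomial (Fin 3) R).IsHomogeneous 1 :=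
    IsHomogeneous.sum _ _ _ fun j _ => isHomogeneous_C_mul_X _ _
  simpa using h.pow (s i)

@[simp] lemma substJet_zero (c : MultiIndex → R) (B : Matrix (Fin 3) (Fin 3) R) :
    substJet c B 0 = c 0 := by
  rw [substJet, linPow_zero, ← C_1, C_apply, contraction_monomial, one_mul]

/-- The chain rule, which determines `substJet` by recursion on the order. -/
lemma substJet_add_single (c : MultiIndex → R) (B : Matrix (Fin 3) (Fin 3) R) (s : MultiIndex)
    (i : Fin 3) : substJet c B (s + Finsupp.single i 1) =
      ∑ j, B j i * substJet (fun t => c (t + Finsupp.single j 1)) B s := by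
  simp only [substJet, linPow_add_single, Finset.mul_sum, map_sum]
  refine Finset.sum_congr rfl fun j _ => ?_
  rw [mul_left_comm, C_mul', map_smul, contraction_mul_X, smul_eq_mul]

lemma substJet_single (c : MultiIndex → R) (B : Matrix (Fin 3) (Fin 3) R) (i : Fin 3) :
    substJet c B (Finsupp.single i 1) = ∑ j, B j i * c (Finsupp.single j 1) := by
  rw [← zero_add (Finsupp.single i 1), substJet_add_single]
  simp

lemma substJet_single_add_single (c : MultiIndex → R) (B : Matrix (Fin 3) (Fin 3) R)
    (i j : Fin 3) : substJet c B (Finsupp.single i 1 + Finsupp.single j 1) =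
      ∑ k, ∑ l, B k j * B l i * c (Finsupp.single l 1 + Finsupp.single k 1) := by
  rw [substJet_add_single]
  simp only [substJet_single, Finset.mul_sum, mul_assoc]

lemma substJet_sum_mul {ι : Type*} (S : Finset ι) (a : ι → R) (c : ι → MultiIndex → R)
    (B : Matrix (Fin 3) (Fin 3) R) (s : MultiIndex) :
    substJet (fun t => ∑ k ∈ S, a k * c k t) B s = ∑ k ∈ S, a k * substJet (c k) B s := by
  simp only [substJet, contraction_eq_sum, Finset.mul_sum]
  rw [Finset.sum_comm]
  exact Finset.sum_congr rfl fun k _ => Finset.sum_congr rfl fun t _ => by ring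

/-- `substJet c B s` only involves the `c t` with `|t| = |s|`. -/
lemma substJet_congr {c c' : MultiIndex → R} (B : Matrix (Fin 3) (Fin 3) R) {s : MultiIndex}
    (h : ∀ t : MultiIndex, t.degree = s.degree → c t = c' t) :
    substJet c B s = substJet c' B s := by
  induction s using multiIndex_induction generalizing c c' with
  | zero => simpa using h 0 rfl
  | add_single s i ih =>
    simp only [substJet_add_single]
    refine Finset.sum_congr rfl fun j _ => ?_
    rw [ih fun t ht => h _ (by simp [ht])]

lemma substJet_mem {S : Type*} [SetLike S R] [SubringClass S R] (A : S) {c : MultiIndex → R}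
    {B : Matrix (Fin 3) (Fin 3) R} {s : MultiIndex} (hB : ∀ i j, B i j ∈ A)
    (hc : ∀ t : MultiIndex, t.degree = s.degree → c t ∈ A) : substJet c B s ∈ A := by
  induction s using multiIndex_induction generalizing c with
  | zero => simpa using hc 0 rfl
  | add_single s i ih =>
    rw [substJet_add_single]
    exact sum_mem fun j _ => mul_mem (hB _ _) (ih fun t ht => hc _ (by simp [ht]))

lemma map_substJet {R' : Type*} [CommRing R'] (f : R →+* R') (c : MultiIndex → R)
    (B : Matrix (Fin 3) (Fin 3) R) (s : MultiIndex) :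
    f (substJet c B s) = substJet (fun t => f (c t)) (B.map f) s := by
  induction s using multiIndex_induction generalizing c with
  | zero => simp
  | add_single s i ih => simp only [substJet_add_single, map_sum, map_mul, ih, Matrix.map_apply]

lemma derivation_substJet {k : Type*} [CommRing k] [Algebra k R] (D : Derivation k R R)
    (c : MultiIndex → R) {B : Matrix (Fin 3) (Fin 3) R} (hB : ∀ i j, D (B i j) = 0)
    (s : MultiIndex) : D (substJet c B s) = substJet (fun t => D (c t)) B s := by
  induction s using multiIndex_induction generalizing c with
  | zero => simp
  | add_single s i ih =>
    simp only [substJet_add_single, map_sum, Derivation.leibniz, hB, ih, smul_eq_mul, mul_zero,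
      add_zero]

lemma substJet_one (c : MultiIndex → R) : substJet c 1 = c := by
  funext s
  induction s using multiIndex_induction generalizing c with
  | zero => simp
  | add_single s i ih => simp [substJet_add_single, ih, Matrix.one_apply]

lemma substJet_substJet (c : MultiIndex → R) (B B' : Matrix (Fin 3) (Fin 3) R) :
    substJet (substJet c B) B' = substJet c (B * B') := by
  funext s
  induction s using multiIndex_induction generalizing c with
  | zero => simp
  | add_single s i ih =>
    simp only [substJet_add_single, substJet_sum_mul, ih, Matrix.mul_apply, Finset.sum_mul,
      Finset.mul_sum]
    rw [Finset.sum_comm]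
    exact Finset.sum_congr rfl fun k _ => Finset.sum_congr rfl fun t _ => by ring

/-- The substitutions `B` and `Bᵀ` are adjoint for the pairing in which the monomials `X ^ s` are
orthogonal with squares `s!`. -/
lemma prod_factorial_mul_coeff_linPow (B : Matrix (Fin 3) (Fin 3) R) (s t : MultiIndex) :
    (∏ j, (Nat.factorial (s j) : R)) * coeff s (linPow B.transpose t) =
      (∏ j, (Nat.factorial (t j) : R)) * coeff t (linPow B s) := by
  have hfac : ∀ (s : MultiIndex) (i : Fin 3),
      (∏ j, (Nat.factorial ((s + Finsupp.single i 1 : MultiIndex) j) : R)) =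
        (∏ j, (Nat.factorial (s j) : R)) * ((s i : R) + 1) := by
    intro s i
    rw [← Finset.mul_prod_erase _ _ (Finset.mem_univ i),
      ← Finset.mul_prod_erase (a := i) (f := fun j => (Nat.factorial (s j) : R)) _
        (Finset.mem_univ i)]
    have : ∀ j ∈ Finset.univ.erase i, (Nat.factorial ((s + Finsupp.single i 1 : MultiIndex) j) : R)
        = (Nat.factorial (s j) : R) := fun j hj => by
      simp [Finsupp.single_eq_of_ne (Finset.ne_of_mem_erase hj)]
    rw [Finset.prod_congr rfl this]
    simp only [Finsupp.add_apply, Finsupp.single_eq_same, Nat.factorial_succ, Nat.cast_mul,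
      Nat.cast_add, Nat.cast_one]
    ring
  -- In this pairing multiplication by `X i` is adjoint to the `i`-th partial derivative.
  induction s using multiIndex_induction generalizing t with
  | zero =>
    have h0 : coeff 0 (linPow B.transpose t) = if t = 0 then 1 else 0 := by
      rw [← constantCoeff_eq, linPow, map_prod]
      split_ifs with h
      · simp [h]
      · obtain ⟨i, hi⟩ := Finsupp.ne_iff.1 h
        have hi' : t i ≠ 0 := hi
        exact Finset.prod_eq_zero (Finset.mem_univ i) (by simp [hi'])
    rw [h0, linPow_zero, coeff_one]
    by_cases h : t = 0
    · simp [h]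
    · simp [h, Ne.symm h]
  | add_single s i ih =>
    have hd : pderiv i (linPow B.transpose t) = ∑ j, C ((t j : R) * B j i) *
        linPow B.transpose (t - Finsupp.single j 1) := by
      have h1 : ∀ j, pderiv i (∑ l, C (B.transpose l j) * X l : MvPolynomial (Fin 3) R) = C (B j i) := by
        intro j
        simp [pderiv_X, Pi.single_apply, Derivation.leibniz]
      have h2 : ∀ (t : MultiIndex) j, t j ≠ 0 → linPow B.transpose t =
          (∑ l, C (B.transpose l j) * X l) * linPow B.transpose (t - Finsupp.single j 1) := by
        intro t j hj
        rw [mul_comm, ← linPow_add_single, tsub_add_cancel_of_le]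
        simpa [Nat.one_le_iff_ne_zero] using hj
      induction t using multiIndex_induction with
      | zero => simp
      | add_single t k iht =>
        rw [linPow_add_single, Derivation.leibniz, h1, iht, smul_eq_mul, smul_eq_mul,
          Finset.mul_sum]
        have h3 : ∀ j, (∑ l, C (B.transpose l k) * X l) * (C ((t j : R) * B j i) *
            linPow B.transpose (t - Finsupp.single j 1)) =
            C ((t j : R) * B j i) * linPow B.transpose (t + Finsupp.single k 1 - Finsupp.single j 1) := by
          intro j
          by_cases hj : t j = 0
          · simp [hj]
          · rw [← tsub_add_eq_add_tsub, linPow_add_single]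
            · ring
            · simpa [Nat.one_le_iff_ne_zero] using hj
        simp only [h3, Finsupp.add_apply, Nat.cast_add, add_mul, map_add, Finset.sum_add_distrib]
        rw [add_comm]
        congr 1
        rw [Finset.sum_eq_single k (fun j _ hj => by simp [Finsupp.single_eq_of_ne hj])
          (by simp), add_tsub_cancel_right]
        simp [mul_comm]
    have hc := coeff_pderiv (i := i) (linPow B.transpose t) s
    have e1 : (∏ j, (Nat.factorial ((s + Finsupp.single i 1 : MultiIndex) j) : R)) *
        coeff (s + Finsupp.single i 1) (linPow B.transpose t) =
        (∏ j, (Nat.factorial (s j) : R)) * coeff s (pderiv i (linPow B.transpose t)) := by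
      rw [hfac, hc]; ring
    rw [e1, hd, coeff_sum, Finset.mul_sum, linPow_add_single, Finset.mul_sum, coeff_sum,
      Finset.mul_sum]
    refine Finset.sum_congr rfl fun j _ => ?_
    rw [coeff_C_mul, mul_left_comm, ih, mul_left_comm (linPow B s), coeff_C_mul, coeff_mul_X']
    by_cases hj : t j = 0
    · simp [hj]
    · rw [if_pos (by simpa using hj)]
      obtain ⟨r, rfl⟩ : ∃ r, t = r + Finsupp.single j 1 :=
        ⟨t - Finsupp.single j 1, (tsub_add_cancel_of_le
          (by simpa [Nat.one_le_iff_ne_zero] using hj)).symm⟩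
      rw [add_tsub_cancel_right, hfac]
      simp
      ring

end Substitution

section SymTensor

variable {K : Type*} [Field K]

lemma mem_finsuppAntidiag_univ {s : MultiIndex} {m : ℕ} :
    s ∈ Finset.finsuppAntidiag Finset.univ m ↔ s.degree = m := by
  rw [Finset.mem_finsuppAntidiag, Finsupp.degree_eq_sum]
  simp

lemma symTensor_eq (c : MultiIndex → K) (B : Matrix (Fin 3) (Fin 3) K) (m : ℕ) :
    symTensor c B m = ∑ t ∈ Finset.finsuppAntidiag Finset.univ m,
      C (c t / ∏ j, (Nat.factorial (t j) : K)) * linPow B.transpose t := rfl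

/-- The coefficients of a tensor in the coordinate coframe are obtained from those in another
coframe by linear substitution. -/
lemma prod_factorial_mul_coeff_symTensor [CharZero K] (c : MultiIndex → K)
    (B : Matrix (Fin 3) (Fin 3) K) (s : MultiIndex) :
    (∏ j, (Nat.factorial (s j) : K)) * coeff s (symTensor c B s.degree) = substJet c B s := by
  rw [symTensor_eq, coeff_sum, Finset.mul_sum, substJet, contraction_eq_sum]
  have h : ∀ t : MultiIndex, (∏ j, (Nat.factorial (s j) : K)) *
      coeff s (C (c t / ∏ j, (Nat.factorial (t j) : K)) * linPow B.transpose t) =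
      coeff t (linPow B s) * c t := by
    intro t
    have h0 : (∏ j, (Nat.factorial (t j) : K)) ≠ 0 :=
      Finset.prod_ne_zero_iff.2 fun j _ => by exact_mod_cast Nat.factorial_ne_zero _
    rw [coeff_C_mul, mul_left_comm, prod_factorial_mul_coeff_linPow]
    field_simp
  simp only [h]
  refine (Finset.sum_subset (fun t ht => ?_) fun t _ ht => ?_).symm
  · rw [mem_finsuppAntidiag_univ]
    by_contra hd
    exact mem_support_iff.1 ht ((linPow_isHomogeneous B s).coeff_eq_zero hd)
  · rw [notMem_support_iff.1 ht, zero_mul]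

lemma symTensor_isHomogeneous (c : MultiIndex → K) (B : Matrix (Fin 3) (Fin 3) K) (m : ℕ) :
    (symTensor c B m).IsHomogeneous m := by
  rw [symTensor_eq]
  refine IsHomogeneous.sum _ _ _ fun t ht => ?_
  rw [mem_finsuppAntidiag_univ] at ht
  exact ht ▸ (linPow_isHomogeneous _ _).C_mul _

lemma forall_symTensor_eq_iff [CharZero K] (c c' : MultiIndex → K)
    (B B' : Matrix (Fin 3) (Fin 3) K) :
    (∀ m, symTensor c B m = symTensor c' B' m) ↔ substJet c B = substJet c' B' := by
  constructor
  · intro h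
    funext s
    rw [← prod_factorial_mul_coeff_symTensor, h, prod_factorial_mul_coeff_symTensor]
  · intro h m
    ext s
    by_cases hs : s.degree = m
    · subst hs
      have h0 : (∏ j, (Nat.factorial (s j) : K)) ≠ 0 :=
        Finset.prod_ne_zero_iff.2 fun j _ => by exact_mod_cast Nat.factorial_ne_zero _
      refine mul_left_cancel₀ h0 ?_
      rw [prod_factorial_mul_coeff_symTensor, prod_factorial_mul_coeff_symTensor, h]
    · rw [(symTensor_isHomogeneous c B m).coeff_eq_zero hs,
        (symTensor_isHomogeneous c' B' m).coeff_eq_zero hs]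

end SymTensor

/-! ### The action on rational functions -/

lemma act_inr (A : Matrix.SpecialLinearGroup (Fin 3) ℂ) (θ : Jet) (s : MultiIndex) :
    act A θ (Sum.inr s) = substJet (fun t => θ (Sum.inr t)) (A⁻¹).1 s :=
  prod_factorial_mul_coeff_symTensor _ _ _

/-- The action preserves the Euler equation, since `∑ x_i d/dx_i` is invariant under linear maps. -/
lemma act_mem {n : ℕ} (A : Matrix.SpecialLinearGroup (Fin 3) ℂ) {θ : Jet}
    (h : θ ∈ eulerEquation n) : act A θ ∈ eulerEquation n := by
  rw [mem_eulerEquation] at h ⊢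
  intro s
  have hA : (A⁻¹).1 * A.1 = 1 := by
    rw [← Matrix.SpecialLinearGroup.coe_mul, inv_mul_cancel, Matrix.SpecialLinearGroup.coe_one]
  simp only [act_inr, substJet_add_single]
  calc ∑ i, act A θ (Sum.inl i) * ∑ j, (A⁻¹).1 j i *
        substJet (fun t => θ (Sum.inr (t + Finsupp.single j 1))) (A⁻¹).1 s
      = ∑ j, ∑ k, ((A⁻¹).1 * A.1) j k * (θ (Sum.inl k) *
        substJet (fun t => θ (Sum.inr (t + Finsupp.single j 1))) (A⁻¹).1 s) := by
        simp only [act, Sum.elim_inl, Matrix.mul_apply, Fin.sum_univ_three]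
        ring
    _ = substJet (fun t => ∑ j, θ (Sum.inl j) * θ (Sum.inr (t + Finsupp.single j 1)))
          (A⁻¹).1 s := by
        rw [hA, substJet_sum_mul]
        simp [Matrix.one_apply]
    _ = substJet (fun t => ∑ _k ∈ {()}, ((n : ℂ) - s.degree) * θ (Sum.inr t)) (A⁻¹).1 s :=
        substJet_congr _ fun t ht => by simp [h, ht]
    _ = _ := by
        rw [substJet_sum_mul]
        simp

lemma act_act_inv (A : Matrix.SpecialLinearGroup (Fin 3) ℂ) (θ : Jet) :
    act A (act A⁻¹ θ) = θ := by
  funext v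
  cases v with
  | inl i =>
    have h := congrArg (fun M : Matrix (Fin 3) (Fin 3) ℂ => M.mulVec (fun j => θ (Sum.inl j)) i)
      (congrArg Subtype.val (mul_inv_cancel A))
    simp only [Matrix.SpecialLinearGroup.coe_mul, ← Matrix.mulVec_mulVec,
      Matrix.SpecialLinearGroup.coe_one, Matrix.one_mulVec] at h
    simpa [act, Matrix.mulVec, dotProduct] using h
  | inr s =>
    rw [act_inr]
    simp only [act_inr, substJet_substJet, ← Matrix.SpecialLinearGroup.coe_mul]
    simp [substJet_one]

/-- The inverse of the matrix `A`, with entries viewed as constant functions on the jet space. -/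
noncomputable def constInv (A : Matrix.SpecialLinearGroup (Fin 3) ℂ) :
    Matrix (Fin 3) (Fin 3) JetPoly :=
  (A⁻¹).1.map C

/-- Composition of polynomial functions with the action of `A`. -/
noncomputable def actPoly (A : Matrix.SpecialLinearGroup (Fin 3) ℂ) : JetPoly →ₐ[ℂ] JetPoly :=
  aeval (Sum.elim (fun i => ∑ j, C (A.1 i j) * xCoord j) (substJet uCoord (constInv A)))

lemma actPoly_xCoord (A : Matrix.SpecialLinearGroup (Fin 3) ℂ) (i : Fin 3) :
    actPoly A (xCoord i) = ∑ j, C (A.1 i j) * xCoord j := by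
  simp [actPoly, xCoord]

lemma actPoly_uCoord (A : Matrix.SpecialLinearGroup (Fin 3) ℂ) (s : MultiIndex) :
    actPoly A (uCoord s) = substJet uCoord (constInv A) s := by
  simp [actPoly, uCoord]

lemma eval_actPoly (A : Matrix.SpecialLinearGroup (Fin 3) ℂ) (θ : Jet) (P : JetPoly) :
    eval θ (actPoly A P) = eval (act A θ) P := by
  induction P using MvPolynomial.induction_on with
  | C a => simp [actPoly]
  | add p q hp hq => simp [hp, hq]
  | mul_X p v hp =>
    rw [map_mul, map_mul, map_mul, hp, eval_X]
    congr 1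
    cases v with
    | inl i =>
      change eval θ (actPoly A (xCoord i)) = _
      rw [actPoly_xCoord]
      simp [xCoord, act]
    | inr s =>
      change eval θ (actPoly A (uCoord s)) = _
      rw [actPoly_uCoord, map_substJet, act_inr]
      congr 1
      · funext t; simp [uCoord]
      · ext i j; simp [constInv]

lemma mem_vanishingIdeal_eulerEquation {n : ℕ} {P : JetPoly} :
    P ∈ vanishingIdeal ℂ (eulerEquation n) ↔ ∀ θ ∈ eulerEquation n, eval θ P = 0 := by
  simp only [mem_vanishingIdeal_iff, ← coe_aeval_eq_eval, RingHom.coe_coe]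

/-- The restriction to the Euler equation as a homomorphism of algebras. -/
noncomputable def restrictHom (n : ℕ) : JetPoly →ₐ[ℂ] RationalFunction n :=
  (IsScalarTower.toAlgHom ℂ (JetPoly ⧸ vanishingIdeal ℂ (eulerEquation n))
    (RationalFunction n)).comp (Ideal.Quotient.mkₐ ℂ _)

lemma restrict_eq (n : ℕ) (P : JetPoly) : restrict n P = restrictHom n P := rfl

lemma restrictHom_eq_zero_iff {n : ℕ} {P : JetPoly} :
    restrictHom n P = 0 ↔ ∀ θ ∈ eulerEquation n, eval θ P = 0 := by
  rw [← restrict_eq, restrict, FaithfulSMul.algebraMap_eq_zero_iff, Ideal.Quotient.eq_zero_iff_mem,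
    mem_vanishingIdeal_eulerEquation]

lemma restrictHom_eq_iff {n : ℕ} {P Q : JetPoly} :
    restrictHom n P = restrictHom n Q ↔ ∀ θ ∈ eulerEquation n, eval θ P = eval θ Q := by
  rw [← sub_eq_zero, ← map_sub, restrictHom_eq_zero_iff]
  simp only [map_sub, sub_eq_zero]

lemma exists_eq_div {n : ℕ} (f : RationalFunction n) :
    ∃ P Q, restrictHom n Q ≠ 0 ∧ f = restrictHom n P / restrictHom n Q := by
  obtain ⟨a, b, hb, rfl⟩ :=
    IsFractionRing.div_surjective (A := JetPoly ⧸ vanishingIdeal ℂ (eulerEquation n)) f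
  obtain ⟨P, rfl⟩ := Ideal.Quotient.mk_surjective a
  obtain ⟨Q, rfl⟩ := Ideal.Quotient.mk_surjective b
  refine ⟨P, Q, fun h => ?_, rfl⟩
  exact nonZeroDivisors.ne_zero hb ((FaithfulSMul.algebraMap_eq_zero_iff _ _).1 h)

/-- Composition of a polynomial function with the action of `A`, as a rational function on the Euler
equation; it only depends on the restriction of the polynomial to the Euler equation. -/
noncomputable def actQuotient (n : ℕ) (A : Matrix.SpecialLinearGroup (Fin 3) ℂ) :
    (JetPoly ⧸ vanishingIdeal ℂ (eulerEquation n)) →ₐ[ℂ] RationalFunction n :=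
  Ideal.Quotient.liftₐ _ ((restrictHom n).comp (actPoly A)) fun P hP =>
    restrictHom_eq_zero_iff.2 fun θ hθ => by
      change eval θ (actPoly A P) = 0
      rw [eval_actPoly]
      exact mem_vanishingIdeal_eulerEquation.1 hP _ (act_mem A hθ)

lemma actQuotient_injective (n : ℕ) (A : Matrix.SpecialLinearGroup (Fin 3) ℂ) :
    Function.Injective (actQuotient n A) := by
  rw [injective_iff_map_eq_zero]
  intro a ha
  obtain ⟨P, rfl⟩ := Ideal.Quotient.mk_surjective a
  rw [Ideal.Quotient.eq_zero_iff_mem, mem_vanishingIdeal_eulerEquation]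
  intro θ hθ
  have h := restrictHom_eq_zero_iff.1 (show restrictHom n (actPoly A P) = 0 from ha) _
    (act_mem A⁻¹ hθ)
  rwa [eval_actPoly, act_act_inv] at h

/-- Composition of rational functions on the Euler equation with the action of `A`. -/
noncomputable def actRat (n : ℕ) (A : Matrix.SpecialLinearGroup (Fin 3) ℂ) :
    RationalFunction n →ₐ[ℂ] RationalFunction n :=
  IsFractionRing.liftAlgHom (actQuotient_injective n A)

lemma actRat_restrictHom (n : ℕ) (A : Matrix.SpecialLinearGroup (Fin 3) ℂ) (P : JetPoly) :
    actRat n A (restrictHom n P) = restrictHom n (actPoly A P) :=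
  IsFractionRing.lift_algebraMap (actQuotient_injective n A) _

/-- `IsDifferentialInvariant` does not depend on the representation as a quotient. -/
lemma isDifferentialInvariant_iff {n : ℕ} {f : RationalFunction n} :
    IsDifferentialInvariant f ↔ ∀ A, actRat n A f = f := by
  constructor
  · intro h A
    obtain ⟨P, Q, hQ, rfl⟩ := exists_eq_div f
    have hQ' : restrictHom n (actPoly A Q) ≠ 0 := by
      rw [← actRat_restrictHom]
      exact (map_ne_zero _).2 hQ
    rw [map_div₀, actRat_restrictHom, actRat_restrictHom, div_eq_div_iff hQ' hQ, ← map_mul,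
      ← map_mul, restrictHom_eq_iff]
    intro θ hθ
    simpa only [map_mul, eval_actPoly] using h A P Q hQ rfl θ hθ
  · rintro h A P Q hQ rfl
    have hA := h A
    simp only [restrict_eq] at hQ hA
    have hQ' : restrictHom n (actPoly A Q) ≠ 0 := by
      rw [← actRat_restrictHom]
      exact (map_ne_zero _).2 hQ
    rw [map_div₀, actRat_restrictHom, actRat_restrictHom, div_eq_div_iff hQ' hQ, ← map_mul,
      ← map_mul, restrictHom_eq_iff] at hA
    intro θ hθ
    simpa only [map_mul, eval_actPoly] using hA θ hθ

/-! ### Equivariance of the coframe -/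

lemma totalDeriv_uCoord (i : Fin 3) (s : MultiIndex) :
    totalDeriv i (uCoord s) = uCoord (s + Finsupp.single i 1) := by
  simp [totalDeriv, uCoord, mkDerivation_X]

lemma totalDeriv_xCoord (i j : Fin 3) :
    totalDeriv i (xCoord j) = if j = i then 1 else 0 := by
  simp [totalDeriv, xCoord, mkDerivation_X]

lemma totalDeriv_C (i : Fin 3) (a : ℂ) : totalDeriv i (C a) = 0 :=
  (totalDeriv i).map_algebraMap a

lemma det_constInv (A : Matrix.SpecialLinearGroup (Fin 3) ℂ) : (constInv A).det = 1 := by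
  rw [constInv, ← RingHom.mapMatrix_apply, ← RingHom.map_det, (A⁻¹).2, map_one]

/-- The total derivatives transform like the partial derivatives on the base. -/
lemma actPoly_totalDeriv (A : Matrix.SpecialLinearGroup (Fin 3) ℂ) (i : Fin 3) (P : JetPoly) :
    actPoly A (totalDeriv i P) = ∑ j, constInv A j i * totalDeriv j (actPoly A P) := by
  induction P using MvPolynomial.induction_on with
  | C a => simp [actPoly]
  | add p q hp hq => simp only [map_add, hp, hq, mul_add, Finset.sum_add_distrib]
  | mul_X p v hp =>
    have hv : actPoly A (totalDeriv i (X v)) =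
        ∑ j, constInv A j i * totalDeriv j (actPoly A (X v)) := by
      cases v with
      | inl k =>
        change actPoly A (totalDeriv i (xCoord k)) =
          ∑ j, constInv A j i * totalDeriv j (actPoly A (xCoord k))
        have h : A.1 * (A⁻¹).1 = 1 := by
          rw [← Matrix.SpecialLinearGroup.coe_mul, mul_inv_cancel,
            Matrix.SpecialLinearGroup.coe_one]
        have hki := congrArg (fun M : Matrix (Fin 3) (Fin 3) ℂ => (C (M k i) : JetPoly)) h
        simp only [Matrix.mul_apply, map_sum, map_mul] at hki
        simp only [actPoly_xCoord, totalDeriv_xCoord, map_sum, Derivation.leibniz, totalDeriv_C,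
          smul_eq_mul, mul_zero, add_zero, mul_ite, mul_one, Finset.sum_ite_eq', Finset.mem_univ,
          if_true, constInv, Matrix.map_apply]
        rw [Finset.sum_congr rfl fun j _ => mul_comm _ _, hki, Matrix.one_apply]
        split_ifs <;> simp
      | inr s =>
        change actPoly A (totalDeriv i (uCoord s)) =
          ∑ j, constInv A j i * totalDeriv j (actPoly A (uCoord s))
        rw [totalDeriv_uCoord, actPoly_uCoord, actPoly_uCoord, substJet_add_single]
        refine Finset.sum_congr rfl fun j _ => ?_
        rw [derivation_substJet (totalDeriv j) uCoord (B := constInv A) fun a b => totalDeriv_C j _]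
        simp only [totalDeriv_uCoord]
    rw [Derivation.leibniz, smul_eq_mul, smul_eq_mul, map_add, map_mul, map_mul, map_mul, hp, hv,
      Finset.mul_sum, Finset.mul_sum, ← Finset.sum_add_distrib]
    refine Finset.sum_congr rfl fun j _ => ?_
    rw [Derivation.leibniz, smul_eq_mul, smul_eq_mul]
    ring

open Matrix in
lemma mulVec_crossProduct_vecMul {R : Type*} [CommRing R] (G : Matrix (Fin 3) (Fin 3) R)
    (a b : Fin 3 → R) : G *ᵥ ((a ᵥ* G) ⨯₃ (b ᵥ* G)) = G.det • (a ⨯₃ b) := by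
  ext i
  fin_cases i <;>
  · simp [Matrix.mulVec, Matrix.vecMul, dotProduct, Fin.sum_univ_three, cross_apply,
      Matrix.det_fin_three]
    ring

open Matrix in
lemma map_crossProduct {R S : Type*} [CommRing R] [CommRing S] (f : R →+* S) (a b : Fin 3 → R) :
    f ∘ (a ⨯₃ b) = (f ∘ a) ⨯₃ (f ∘ b) := by
  ext i
  fin_cases i <;> simp [cross_apply]

section

open Matrix

variable (A : Matrix.SpecialLinearGroup (Fin 3) ℂ)

lemma actPoly_omega1 : actPoly A ∘ omega1 = omega1 ᵥ* constInv A := by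
  ext1 i
  simp only [Function.comp, omega1, actPoly_uCoord, substJet_single, Matrix.vecMul, dotProduct,
    constInv]
  exact Finset.sum_congr rfl fun j _ => mul_comm _ _

lemma hessian_map_actPoly :
    hessian.map (actPoly A) = (constInv A)ᵀ * hessian * constInv A := by
  ext1 i j
  simp only [Matrix.map_apply, hessian, Matrix.of_apply, actPoly_uCoord,
    substJet_single_add_single, Matrix.mul_apply, Matrix.transpose_apply, Finset.sum_mul, constInv]
  exact Finset.sum_congr rfl fun k _ => Finset.sum_congr rfl fun l _ => by ring

lemma actPoly_det_hessian : actPoly A hessian.det = hessian.det := by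
  have h : actPoly A hessian.det = (hessian.map (actPoly A)).det :=
    (actPoly A).toRingHom.map_det hessian
  rw [h, hessian_map_actPoly, Matrix.det_mul, Matrix.det_mul, Matrix.det_transpose, det_constInv,
    one_mul, mul_one]

lemma actPoly_omega2 : actPoly A ∘ omega2 = omega2 ᵥ* constInv A := by
  ext1 i
  simp only [Function.comp, omega2, actPoly_totalDeriv, actPoly_det_hessian, Matrix.vecMul,
    dotProduct]
  exact Finset.sum_congr rfl fun j _ => mul_comm _ _

lemma actPoly_omega3 : actPoly A ∘ omega3 = omega3 ᵥ* constInv A := by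
  have h1 : actPoly A ∘ omega3 =
      hessian.map (actPoly A) *ᵥ (actPoly A ∘ (omega1 ⨯₃ omega2)) := by
    ext1 i
    exact (actPoly A).toRingHom.map_mulVec hessian _ i
  have h2 : actPoly A ∘ (omega1 ⨯₃ omega2) = (actPoly A ∘ omega1) ⨯₃ (actPoly A ∘ omega2) :=
    map_crossProduct (actPoly A).toRingHom _ _
  rw [h1, h2, hessian_map_actPoly, actPoly_omega1, actPoly_omega2, ← Matrix.mulVec_mulVec,
    mulVec_crossProduct_vecMul, det_constInv, one_smul, ← Matrix.mulVec_mulVec,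
    Matrix.mulVec_transpose, omega3]

/-- The matrix of the coefficients of the coframe as polynomials on the jet space. -/
noncomputable def coframePoly : Matrix (Fin 3) (Fin 3) JetPoly :=
  Matrix.of ![omega1, omega2, omega3]

lemma coframePoly_map_actPoly : coframePoly.map (actPoly A) = coframePoly * constInv A := by
  ext1 i j
  rw [Matrix.mul_apply_eq_vecMul]
  fin_cases i
  · exact congrFun (actPoly_omega1 A) j
  · exact congrFun (actPoly_omega2 A) j
  · exact congrFun (actPoly_omega3 A) j

lemma coframe_eq (n : ℕ) : coframe n = coframePoly.map (restrictHom n) := rfl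

lemma coframe_map_actRat (n : ℕ) :
    (coframe n).map (actRat n A) = coframe n * (A⁻¹).1.map (algebraMap ℂ (RationalFunction n)) := by
  have h1 : (coframe n).map (actRat n A) = (coframePoly.map (actPoly A)).map (restrictHom n) := by
    ext1 i j
    exact actRat_restrictHom n A _
  have h2 : (constInv A).map (restrictHom n) =
      (A⁻¹).1.map (algebraMap ℂ (RationalFunction n)) := by
    ext1 i j
    exact (restrictHom n).commutes _
  rw [h1, coframePoly_map_actPoly, ← h2, coframe_eq]
  exact Matrix.map_mul (f := (restrictHom n).toRingHom)

end

/-! ### Nonvanishing of the coframe -/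

open Matrix in
/-- A point of the Euler equation where neither the Hessian determinant nor the determinant of the
coframe vanishes: the jet at `(1, 0, 0)` of a function, homogeneous of degree `n`, whose restriction
to the plane `x = 1` has the Taylor polynomial `1 + y² / 2 + z² / 2 + y³ / 6`. -/
lemma exists_nondegenerate_jet (n : ℕ) (hn : 2 ≤ n) : ∃ θ ∈ eulerEquation n,
    eval θ hessian.det ≠ 0 ∧ eval θ coframePoly.det ≠ 0 := by
  let x : Fin 3 → ℂ := ![1, 0, 0]
  let w : MultiIndex → ℂ := fun s =>
    if s = 0 ∨ s = Finsupp.single 1 2 ∨ s = Finsupp.single 2 2 ∨ s = Finsupp.single 1 3 then 1 else 0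
  have hx : x 0 ≠ 0 := by simp [x]
  obtain ⟨θ, hθdef⟩ : ∃ θ, θ = chartPoint n 0 x w := ⟨_, rfl⟩
  have hθ : θ ∈ eulerEquation n := hθdef ▸ chartPoint_mem n 0 x w hx
  have hx0 : θ (Sum.inl 0) = 1 := by rw [hθdef]; rfl
  have hx1 : θ (Sum.inl 1) = 0 := by rw [hθdef]; rfl
  have hx2 : θ (Sum.inl 2) = 0 := by rw [hθdef]; rfl
  -- Over `(1, 0, 0)` the Euler equation expresses the derivatives of `u` in the direction of `x`.
  have hrec : ∀ s : MultiIndex, θ (Sum.inr (Finsupp.single 0 1 + s)) =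
      ((n : ℂ) - s.degree) * θ (Sum.inr s) := by
    intro s
    have h := mem_eulerEquation.1 hθ s
    rw [Fin.sum_univ_three, hx0, hx1, hx2] at h
    rw [add_comm]
    simpa using h
  have hbase : ∀ s : MultiIndex, s 0 = 0 → θ (Sum.inr s) = w s := by
    intro s hs
    simp [hθdef, chartPoint, hs, chart]
  have hw : ∀ s : MultiIndex, w s = if (s 0 = 0 ∧ s 1 = 0 ∧ s 2 = 0) ∨
      (s 0 = 0 ∧ s 1 = 2 ∧ s 2 = 0) ∨ (s 0 = 0 ∧ s 1 = 0 ∧ s 2 = 2) ∨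
      (s 0 = 0 ∧ s 1 = 3 ∧ s 2 = 0) then 1 else 0 := by
    intro s
    simp [w, Finsupp.ext_iff, Fin.forall_fin_succ]
  have e1 : θ (Sum.inr (Finsupp.single 1 1)) = 0 := by
    rw [hbase _ (by simp), hw]; simp
  have e2 : θ (Sum.inr (Finsupp.single 2 1)) = 0 := by
    rw [hbase _ (by simp), hw]; simp
  have e0 : θ (Sum.inr (Finsupp.single 0 1)) = n := by
    have h := hrec 0
    rw [hbase 0 (by simp), hw] at h
    simpa using h
  have h00 : θ (Sum.inr (Finsupp.single 0 1 + Finsupp.single 0 1)) = (n - 1) * n := by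
    rw [hrec, e0]; simp
  have h01 : θ (Sum.inr (Finsupp.single 0 1 + Finsupp.single 1 1)) = 0 := by
    rw [hrec, e1, mul_zero]
  have h02 : θ (Sum.inr (Finsupp.single 0 1 + Finsupp.single 2 1)) = 0 := by
    rw [hrec, e2, mul_zero]
  have h10 : θ (Sum.inr (Finsupp.single 1 1 + Finsupp.single 0 1)) = 0 := by rw [add_comm, h01]
  have h20 : θ (Sum.inr (Finsupp.single 2 1 + Finsupp.single 0 1)) = 0 := by rw [add_comm, h02]
  have h11 : θ (Sum.inr (Finsupp.single 1 1 + Finsupp.single 1 1)) = 1 := by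
    rw [hbase _ (by simp), hw]; simp
  have h12 : θ (Sum.inr (Finsupp.single 1 1 + Finsupp.single 2 1)) = 0 := by
    rw [hbase _ (by simp), hw]; simp
  have h21 : θ (Sum.inr (Finsupp.single 2 1 + Finsupp.single 1 1)) = 0 := by rw [add_comm, h12]
  have h22 : θ (Sum.inr (Finsupp.single 2 1 + Finsupp.single 2 1)) = 1 := by
    rw [hbase _ (by simp), hw]; simp
  have h001 : θ (Sum.inr (Finsupp.single 0 1 + Finsupp.single 0 1 + Finsupp.single 1 1)) = 0 := by
    rw [add_assoc, hrec, h01, mul_zero]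
  have h002 : θ (Sum.inr (Finsupp.single 0 1 + Finsupp.single 0 1 + Finsupp.single 2 1)) = 0 := by
    rw [add_assoc, hrec, h02, mul_zero]
  have h111 : θ (Sum.inr (Finsupp.single 1 1 + Finsupp.single 1 1 + Finsupp.single 1 1)) = 1 := by
    rw [hbase _ (by simp), hw]; simp
  have h112 : θ (Sum.inr (Finsupp.single 1 1 + Finsupp.single 1 1 + Finsupp.single 2 1)) = 0 := by
    rw [hbase _ (by simp), hw]; simp
  have h221 : θ (Sum.inr (Finsupp.single 2 1 + Finsupp.single 2 1 + Finsupp.single 1 1)) = 0 := by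
    rw [hbase _ (by simp), hw]; simp
  have h222 : θ (Sum.inr (Finsupp.single 2 1 + Finsupp.single 2 1 + Finsupp.single 2 1)) = 0 := by
    rw [hbase _ (by simp), hw]; simp
  have hu : ∀ s, eval θ (uCoord s) = θ (Sum.inr s) := fun s => eval_X _
  have hH : ∀ i j, eval θ (hessian i j) =
      θ (Sum.inr (Finsupp.single i 1 + Finsupp.single j 1)) := fun i j => eval_X _
  have hn0 : (n : ℂ) ≠ 0 := by exact_mod_cast (by omega : n ≠ 0)
  have hn1 : (n : ℂ) - 1 ≠ 0 := by
    rw [sub_ne_zero]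
    exact_mod_cast (by omega : n ≠ 1)
  -- The Hessian matrix is diagonal here, so only the derivatives of its diagonal entries contribute
  -- to those of its determinant; the first entry of `ω₂` does not matter as `ω₁ = (n, 0, 0)`.
  have w1 : eval θ (omega2 1) = (n - 1) * n := by
    simp [omega2, det_fin_three, hessian, hu, totalDeriv_uCoord, h00, h01, h02, h10, h11, h12,
      h20, h21, h22, h001, h111, h221]
  have w2 : eval θ (omega2 2) = 0 := by
    simp [omega2, det_fin_three, hessian, hu, totalDeriv_uCoord, h00, h01, h02, h10, h11, h12,
      h20, h21, h22, h002, h112, h222]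
  refine ⟨θ, hθ, ?_, ?_⟩
  · have h : eval θ hessian.det = (n - 1) * n := by
      simp [det_fin_three, hessian, hu, h00, h01, h02, h10, h11, h12, h20, h21, h22]
    rw [h]
    exact mul_ne_zero hn1 hn0
  · have w3 : eval θ (omega3 2) = n * ((n - 1) * n) := by
      simp [omega3, omega1, cross_apply, mulVec, dotProduct, Fin.sum_univ_three, hH, hu, w1, w2,
        e0, e1, e2, h20, h21, h22]
    have h : eval θ coframePoly.det = n * ((n - 1) * n) * (n * ((n - 1) * n)) := by
      simp [det_fin_three, coframePoly, omega1, hu, w1, w2, w3, e0, e1, e2]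
    rw [h]
    exact mul_ne_zero (mul_ne_zero hn0 (mul_ne_zero hn1 hn0))
      (mul_ne_zero hn0 (mul_ne_zero hn1 hn0))

lemma restrictHom_det_hessian_ne_zero {n : ℕ} (hn : 2 ≤ n) : restrictHom n hessian.det ≠ 0 := by
  obtain ⟨θ, hθ, h, -⟩ := exists_nondegenerate_jet n hn
  exact fun h0 => h (restrictHom_eq_zero_iff.1 h0 θ hθ)

lemma restrictHom_det_coframePoly (n : ℕ) :
    restrictHom n coframePoly.det = (coframe n).det :=
  (restrictHom n).toRingHom.map_det coframePoly

lemma det_coframe_ne_zero {n : ℕ} (hn : 2 ≤ n) : (coframe n).det ≠ 0 := by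
  obtain ⟨θ, hθ, -, h⟩ := exists_nondegenerate_jet n hn
  rw [← restrictHom_det_coframePoly]
  exact fun h0 => h (restrictHom_eq_zero_iff.1 h0 θ hθ)

instance (n : ℕ) : CharZero (RationalFunction n) :=
  charZero_of_injective_algebraMap (algebraMap ℂ (RationalFunction n)).injective

/-- The Hessian matrix on the Euler equation. -/
noncomputable def hessianRat (n : ℕ) : Matrix (Fin 3) (Fin 3) (RationalFunction n) :=
  hessian.map (restrictHom n)

lemma det_hessianRat_ne_zero {n : ℕ} (hn : 2 ≤ n) : (hessianRat n).det ≠ 0 := by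
  have h : restrictHom n hessian.det = (hessianRat n).det :=
    (restrictHom n).toRingHom.map_det hessian
  exact h ▸ restrictHom_det_hessian_ne_zero hn

open Matrix in
lemma coframe_two (n : ℕ) :
    coframe n 2 = hessianRat n *ᵥ (coframe n 0 ⨯₃ coframe n 1) := by
  have h1 : coframe n 2 = hessianRat n *ᵥ (restrictHom n ∘ (omega1 ⨯₃ omega2)) := by
    ext1 i
    exact (restrictHom n).toRingHom.map_mulVec hessian _ i
  rw [h1]
  congr 1
  exact map_crossProduct (restrictHom n).toRingHom _ _

open Matrix in
lemma theta2Inv_mulVec_coframe_two {n : ℕ} (hn : 2 ≤ n) :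
    theta2Inv n *ᵥ coframe n 2 = (2 : RationalFunction n) • (coframe n 0 ⨯₃ coframe n 1) := by
  have hu : IsUnit ((1 / 2 : RationalFunction n) • hessianRat n).det := by
    rw [det_smul]
    exact (mul_ne_zero (pow_ne_zero _ (by norm_num)) (det_hessianRat_ne_zero hn)).isUnit
  have h : coframe n 2 = ((1 / 2 : RationalFunction n) • hessianRat n) *ᵥ
      ((2 : RationalFunction n) • (coframe n 0 ⨯₃ coframe n 1)) := by
    rw [coframe_two, smul_mulVec, mulVec_smul, smul_smul]
    norm_num
  have h2 : theta2Inv n = ((1 / 2 : RationalFunction n) • hessianRat n)⁻¹ := rfl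
  rw [h, h2, mulVec_mulVec, nonsing_inv_mul _ hu, one_mulVec]

/-! ### The invariant coefficients -/

/-- The jet coordinates `u_s` on the Euler equation. -/
noncomputable def uRat (n : ℕ) (s : MultiIndex) : RationalFunction n := restrictHom n (uCoord s)

/-- The coefficients of the tensors `Θ_m` in the coframe `ω₁, ω₂, ω₃`. -/
noncomputable def invariantCoeff (n : ℕ) : MultiIndex → RationalFunction n :=
  substJet (uRat n) (coframe n)⁻¹

lemma substJet_injective {K : Type*} [CommRing K] {B : Matrix (Fin 3) (Fin 3) K}
    (hB : IsUnit B.det) : Function.Injective fun c => substJet c B := by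
  intro c c' h
  have h' := congrArg (fun c => substJet c B⁻¹) h
  simpa only [substJet_substJet, Matrix.mul_nonsing_inv _ hB, substJet_one] using h'

lemma isExpansion_iff_substJet (n : ℕ) (J : MultiIndex → RationalFunction n) :
    IsExpansion n J ↔ substJet J (coframe n) = uRat n := by
  have h := forall_symTensor_eq_iff (uRat n) J 1 (coframe n)
  rw [substJet_one] at h
  exact h.trans eq_comm

lemma substJet_invariantCoeff {n : ℕ} (hn : 2 ≤ n) :
    substJet (invariantCoeff n) (coframe n) = uRat n := by
  rw [invariantCoeff, substJet_substJet,
    Matrix.nonsing_inv_mul _ (det_coframe_ne_zero hn).isUnit, substJet_one]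

lemma isExpansion_iff {n : ℕ} (hn : 2 ≤ n) (J : MultiIndex → RationalFunction n) :
    IsExpansion n J ↔ J = invariantCoeff n := by
  rw [isExpansion_iff_substJet, ← substJet_invariantCoeff hn]
  exact (substJet_injective (det_coframe_ne_zero hn).isUnit).eq_iff

lemma actRat_uRat (n : ℕ) (A : Matrix.SpecialLinearGroup (Fin 3) ℂ) (s : MultiIndex) :
    actRat n A (uRat n s) =
      substJet (uRat n) ((A⁻¹).1.map (algebraMap ℂ (RationalFunction n))) s := by
  rw [uRat, actRat_restrictHom, actPoly_uCoord]
  have h := map_substJet (restrictHom n).toRingHom uCoord (constInv A) s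
  have h2 : (constInv A).map (restrictHom n) =
      (A⁻¹).1.map (algebraMap ℂ (RationalFunction n)) := by
    ext1 i j
    exact (restrictHom n).commutes _
  rw [← h2]
  exact h

/-- The coefficients are invariant because both the tensors and the coframe are. -/
lemma actRat_invariantCoeff {n : ℕ} (hn : 2 ≤ n) (A : Matrix.SpecialLinearGroup (Fin 3) ℂ)
    (s : MultiIndex) : actRat n A (invariantCoeff n s) = invariantCoeff n s := by
  set G := (A⁻¹).1.map (algebraMap ℂ (RationalFunction n)) with hG
  have hGu : IsUnit G.det := by
    rw [hG, ← RingHom.mapMatrix_apply, ← RingHom.map_det, (A⁻¹).2, map_one]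
    exact isUnit_one
  -- By uniqueness it is enough to compare the images of the expansions under the action.
  suffices h : (fun t => actRat n A (invariantCoeff n t)) = invariantCoeff n from congrFun h s
  apply substJet_injective (det_coframe_ne_zero hn).isUnit
  apply substJet_injective hGu
  change substJet (substJet _ _) _ = substJet (substJet _ _) _
  rw [substJet_invariantCoeff hn, substJet_substJet, hG, ← coframe_map_actRat]
  funext t
  rw [← actRat_uRat, ← substJet_invariantCoeff hn]
  exact (map_substJet (actRat n A).toRingHom _ _ _).symm

/-! ### Orders of the invariants -/

lemma det_mem {K S ι : Type*} [CommRing K] [SetLike S K] [SubringClass S K] [Fintype ι]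
    [DecidableEq ι] (F : S) {M : Matrix ι ι K} (h : ∀ i j, M i j ∈ F) : M.det ∈ F := by
  rw [Matrix.det_apply]
  refine sum_mem fun σ _ => ?_
  rw [Units.smul_def]
  exact zsmul_mem (prod_mem fun i _ => h _ _) _

lemma inv_apply_mem {K S ι : Type*} [Field K] [SetLike S K] [SubfieldClass S K] [Fintype ι]
    [DecidableEq ι] (F : S) {M : Matrix ι ι K} (h : ∀ i j, M i j ∈ F) (i j : ι) :
    M⁻¹ i j ∈ F := by
  rw [Matrix.inv_def, Matrix.smul_apply, Ring.inverse_eq_inv', smul_eq_mul, Matrix.adjugate_apply]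
  refine mul_mem (inv_mem (det_mem F h)) (det_mem F fun k l => ?_)
  rw [Matrix.updateRow_apply]
  split_ifs
  · rw [Pi.single_apply]
    split_ifs
    · exact one_mem F
    · exact zero_mem F
  · exact h k l

lemma uRat_mem_orderLE {n k : ℕ} {s : MultiIndex} (h : s.degree ≤ k) : uRat n s ∈ orderLE n k :=
  IntermediateField.subset_adjoin _ _ (Or.inr ⟨s, h, rfl⟩)

open Matrix in
lemma coframe_mem_orderLE (n : ℕ) (i j : Fin 3) : coframe n i j ∈ orderLE n 3 := by
  let F : Subring JetPoly := (orderLE n 3).toSubfield.toSubring.comap (restrictHom n).toRingHom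
  have hu : ∀ s : MultiIndex, s.degree ≤ 3 → uCoord s ∈ F := fun s hs => uRat_mem_orderLE hs
  have h1 : ∀ i, omega1 i ∈ F := fun i => hu _ (by simp)
  have hH : ∀ i j, hessian i j ∈ F := fun i j => hu _ (by simp)
  have hdH : ∀ i j k, totalDeriv k (hessian i j) ∈ F := fun i j k => by
    rw [hessian, of_apply, totalDeriv_uCoord]
    exact hu _ (by simp)
  -- The polynomials in this field whose first total derivatives are in it as well form a ring.
  let E : Subring JetPoly :=
    { carrier := {P | P ∈ F ∧ ∀ k, totalDeriv k P ∈ F}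
      zero_mem' := ⟨zero_mem F, fun k => by rw [map_zero]; exact zero_mem F⟩
      one_mem' := ⟨one_mem F, fun k => by rw [Derivation.map_one_eq_zero]; exact zero_mem F⟩
      add_mem' := fun hP hQ => ⟨add_mem hP.1 hQ.1, fun k => by
        rw [map_add]
        exact add_mem (hP.2 k) (hQ.2 k)⟩
      neg_mem' := fun hP => ⟨neg_mem hP.1, fun k => by
        rw [map_neg]
        exact neg_mem (hP.2 k)⟩
      mul_mem' := fun hP hQ => ⟨mul_mem hP.1 hQ.1, fun k => by
        rw [Derivation.leibniz]
        exact add_mem (mul_mem hP.1 (hQ.2 k)) (mul_mem hQ.1 (hP.2 k))⟩ }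
  have h2 : ∀ i, omega2 i ∈ F := fun i =>
    (det_mem E fun i j => ⟨hH i j, fun k => hdH i j k⟩ : hessian.det ∈ E).2 i
  have h3 : ∀ i, omega3 i ∈ F := fun i => by
    simp only [omega3, mulVec, dotProduct]
    refine sum_mem fun j _ => mul_mem (hH _ _) ?_
    rw [cross_apply]
    fin_cases j <;> exact sub_mem (mul_mem (h1 _) (h2 _)) (mul_mem (h1 _) (h2 _))
  fin_cases i
  · exact h1 j
  · exact h2 j
  · exact h3 j

open Matrix in
lemma invariantCoeff_single {n : ℕ} (hn : 2 ≤ n) (i : Fin 3) :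
    invariantCoeff n (Finsupp.single i 1) = if i = 0 then 1 else 0 := by
  rw [invariantCoeff, substJet_single]
  have h := congrFun (congrFun (mul_nonsing_inv (coframe n) (det_coframe_ne_zero hn).isUnit) 0) i
  rw [mul_apply, one_apply] at h
  simp only [eq_comm (a := i)]
  rw [← h]
  exact Finset.sum_congr rfl fun j _ => mul_comm _ _

lemma invariantCoeff_mem_orderLE {n : ℕ} (hn : 2 ≤ n) (s : MultiIndex) :
    invariantCoeff n s ∈ orderLE n (if s.degree = 2 then 3 else s.degree) := by
  have h3 : ∀ k, 3 ≤ k → ∀ i j, (coframe n)⁻¹ i j ∈ orderLE n k := fun k hk i j => by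
    refine inv_apply_mem _ (fun i j => ?_) i j
    refine IntermediateField.adjoin.mono _ _ _ ?_ (coframe_mem_orderLE n i j)
    exact Set.union_subset_union_right _ (Set.image_mono fun s hs => le_trans hs hk)
  have hbig : ∀ k, 3 ≤ k → s.degree ≤ k → invariantCoeff n s ∈ orderLE n k := fun k hk hs =>
    substJet_mem _ (h3 k hk) fun t ht => uRat_mem_orderLE (ht.trans_le hs)
  split_ifs with h2
  · exact hbig 3 le_rfl (by omega)
  · rcases Nat.lt_or_ge s.degree 3 with h | h
    · obtain h0 | h1 : s.degree = 0 ∨ s.degree = 1 := by omega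
      · obtain rfl := (Finsupp.degree_eq_zero_iff s).1 h0
        rw [invariantCoeff, substJet_zero]
        exact uRat_mem_orderLE le_rfl
      · obtain ⟨i, rfl⟩ : ∃ i, s = Finsupp.single i 1 := by
          have hs : s ≠ 0 := by rintro rfl; simp at h1
          obtain ⟨i, hi⟩ := Finsupp.ne_iff.1 hs
          have hle : Finsupp.single i 1 ≤ s := by simpa [Nat.one_le_iff_ne_zero] using hi
          obtain ⟨r, rfl⟩ := exists_add_of_le hle
          have hr : r.degree = 0 := by simpa using h1
          rw [(Finsupp.degree_eq_zero_iff r).1 hr]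
          exact ⟨i, add_zero _⟩
        rw [invariantCoeff_single hn]
        split_ifs
        · exact one_mem _
        · exact zero_mem _
    · exact hbig _ h le_rfl

/-! ### Localization at nondegenerate jets -/

/-- The functions `P / δ ^ k` on the space of jets, where `δ` is the determinant of the coframe. -/
abbrev NondegenerateFunction : Type := Localization.Away coframePoly.det

/-- The value of `P / δ ^ k` at a jet with `δ ≠ 0`. -/
noncomputable def evalAway (θ : Jet) (h : eval θ coframePoly.det ≠ 0) :
    NondegenerateFunction →+* ℂ :=
  IsLocalization.Away.lift coframePoly.det (g := eval θ) h.isUnit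

lemma evalAway_algebraMap (θ : Jet) (h : eval θ coframePoly.det ≠ 0) (P : JetPoly) :
    evalAway θ h (algebraMap JetPoly NondegenerateFunction P) = eval θ P :=
  IsLocalization.Away.lift_eq _ _ _

/-- The restriction of `P / δ ^ k` to the Euler equation. -/
noncomputable def restrictAway {n : ℕ} (hn : 2 ≤ n) : NondegenerateFunction →+* RationalFunction n :=
  IsLocalization.Away.lift coframePoly.det (g := (restrictHom n).toRingHom)
    (restrictHom_det_coframePoly n ▸ det_coframe_ne_zero hn : restrictHom n coframePoly.det ≠ 0).isUnit

lemma restrictAway_algebraMap {n : ℕ} (hn : 2 ≤ n) (P : JetPoly) :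
    restrictAway hn (algebraMap JetPoly NondegenerateFunction P) = restrictHom n P :=
  IsLocalization.Away.lift_eq _ _ _

/-- A function with nondegenerate denominator is zero on the Euler equation if and only if it
vanishes at all nondegenerate points of the Euler equation. -/
lemma restrictAway_eq_zero_iff {n : ℕ} (hn : 2 ≤ n) (l : NondegenerateFunction) :
    restrictAway hn l = 0 ↔ ∀ θ ∈ eulerEquation n, ∀ h, evalAway θ h l = 0 := by
  obtain ⟨k, P, hP⟩ := IsLocalization.Away.surj coframePoly.det l
  have hδ : restrictHom n coframePoly.det ≠ 0 :=
    restrictHom_det_coframePoly n ▸ det_coframe_ne_zero hn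
  have h1 : restrictAway hn l = 0 ↔ restrictHom n P = 0 := by
    have := congrArg (restrictAway hn) hP
    rw [map_mul, map_pow, restrictAway_algebraMap, restrictAway_algebraMap] at this
    rw [← this, mul_eq_zero, or_iff_left (pow_ne_zero _ hδ)]
  have h2 : ∀ θ h, evalAway θ h l = 0 ↔ eval θ P = 0 := fun θ h => by
    have := congrArg (evalAway θ h) hP
    rw [map_mul, map_pow, evalAway_algebraMap, evalAway_algebraMap] at this
    rw [← this, mul_eq_zero, or_iff_left (pow_ne_zero _ h)]
  simp only [h1, h2]
  constructor
  · exact fun h θ hθ _ => restrictHom_eq_zero_iff.1 h θ hθ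
  · intro h
    have h0 : restrictHom n (P * coframePoly.det) = 0 := by
      refine restrictHom_eq_zero_iff.2 fun θ hθ => ?_
      rw [map_mul, mul_eq_zero, or_iff_not_imp_right]
      exact h θ hθ
    rw [map_mul] at h0
    exact (mul_eq_zero.1 h0).resolve_right hδ

/-! ### Moving a jet so that its coframe becomes diagonal -/

section LinearMove

open Matrix

variable {R S : Type*} [CommRing R] [CommRing S]

/-- The action of an invertible matrix `M` on jets with coordinates in a ring `R`. -/
noncomputable def move (M : Matrix (Fin 3) (Fin 3) R) (θ : JetVar → R) : JetVar → R :=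
  Sum.elim (M *ᵥ fun i => θ (Sum.inl i)) (substJet (fun s => θ (Sum.inr s)) M⁻¹)

lemma map_matrix_inv (f : R →+* S) {M : Matrix (Fin 3) (Fin 3) R} (hM : IsUnit M.det) :
    M⁻¹.map f = (M.map f)⁻¹ := by
  refine (inv_eq_right_inv ?_).symm
  rw [← Matrix.map_mul, mul_nonsing_inv _ hM, Matrix.map_one _ (map_zero f) (map_one f)]

lemma map_move (f : R →+* S) {M : Matrix (Fin 3) (Fin 3) R} (hM : IsUnit M.det)
    (θ : JetVar → R) (v : JetVar) : f (move M θ v) = move (M.map f) (fun v => f (θ v)) v := by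
  cases v with
  | inl i => exact f.map_mulVec M (fun i => θ (Sum.inl i)) i
  | inr s =>
    simp only [move, Sum.elim_inr]
    rw [map_substJet, map_matrix_inv f hM]

lemma act_eq_move (A : Matrix.SpecialLinearGroup (Fin 3) ℂ) (θ : Jet) : act A θ = move A.1 θ := by
  funext v
  cases v with
  | inl i => rfl
  | inr s =>
    rw [act_inr]
    have h : (A⁻¹).1 = (A.1)⁻¹ := by
      refine (inv_eq_right_inv ?_).symm
      rw [← Matrix.SpecialLinearGroup.coe_mul, mul_inv_cancel, Matrix.SpecialLinearGroup.coe_one]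
    rw [h]
    rfl

lemma move_one (θ : JetVar → R) : move 1 θ = θ := by
  funext v
  cases v <;> simp [move, substJet_one]

end LinearMove

section Slice

open Matrix

/-- The matrix of the invariants of second order: the Hessian matrix in the invariant coframe. -/
noncomputable def invariantHessian (n : ℕ) : Matrix (Fin 3) (Fin 3) (RationalFunction n) :=
  of fun i j => invariantCoeff n (Finsupp.single i 1 + Finsupp.single j 1)

lemma hessianRat_eq {n : ℕ} (hn : 2 ≤ n) :
    hessianRat n = (coframe n)ᵀ * invariantHessian n * coframe n := by
  ext1 i j
  have h : hessianRat n i j = uRat n (Finsupp.single i 1 + Finsupp.single j 1) := rfl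
  rw [h, ← substJet_invariantCoeff hn, substJet_single_add_single]
  simp only [mul_apply, transpose_apply, Finset.sum_mul, invariantHessian, of_apply]
  exact Finset.sum_congr rfl fun k _ => Finset.sum_congr rfl fun l _ => by ring

lemma isUnit_det_invariantHessian {n : ℕ} (hn : 2 ≤ n) : IsUnit (invariantHessian n).det := by
  have h := det_hessianRat_ne_zero hn
  rw [hessianRat_eq hn, det_mul, det_mul] at h
  exact (right_ne_zero_of_mul (left_ne_zero_of_mul h)).isUnit

/-- The equation `H y = c ω_i` in the coframe `B`, where `H` has the matrix `S`. -/
lemma mulVec_mulVec_eq_smul_single {K : Type*} [Field K] {B S : Matrix (Fin 3) (Fin 3) K}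
    (hB : B.det ≠ 0) {y : Fin 3 → K} {c : K} {i : Fin 3} (h : (Bᵀ * S * B) *ᵥ y = c • B i) :
    S *ᵥ (B *ᵥ y) = c • Pi.single i 1 := by
  have hB' : IsUnit B := (isUnit_iff_isUnit_det _).2 hB.isUnit
  apply vecMul_injective_of_isUnit hB'
  change _ ᵥ* _ = _ ᵥ* _
  rw [← mulVec_transpose, mulVec_mulVec, mulVec_mulVec, h, smul_vecMul,
    single_one_vecMul]
  rfl

lemma mulVec_crossProduct_rows {R : Type*} [CommRing R] (M : Matrix (Fin 3) (Fin 3) R) :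
    M *ᵥ (M 0 ⨯₃ M 1) = Pi.single 2 M.det := by
  ext i
  fin_cases i <;>
  · simp [mulVec, dotProduct, Fin.sum_univ_three, cross_apply, det_fin_three]
    ring

lemma apply_two_two_mul_det {K : Type*} [Field K] {B S : Matrix (Fin 3) (Fin 3) K}
    (hB : B.det ≠ 0) (h : B 2 = (Bᵀ * S * B) *ᵥ (B 0 ⨯₃ B 1)) : S 2 2 * B.det = 1 := by
  have h' := mulVec_mulVec_eq_smul_single hB (c := 1) (i := 2) (by rw [← h, one_smul])
  rw [mulVec_crossProduct_rows] at h'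
  simpa [mulVec_single] using congrFun h' 2

/-- The coordinates `x_i` on the Euler equation. -/
noncomputable def xRat (n : ℕ) (i : Fin 3) : RationalFunction n := restrictHom n (xCoord i)

lemma hessianRat_mulVec_xRat (n : ℕ) :
    hessianRat n *ᵥ xRat n = ((n : RationalFunction n) - 1) • coframe n 0 := by
  ext1 i
  have h : restrictHom n (∑ j, uCoord (Finsupp.single i 1 + Finsupp.single j 1) * xCoord j) =
      restrictHom n (C ((n : ℂ) - 1) * uCoord (Finsupp.single i 1)) := by
    refine restrictHom_eq_iff.2 fun θ hθ => ?_
    have h1 := mem_eulerEquation.1 hθ (Finsupp.single i 1)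
    simp only [map_sum, map_mul, xCoord, uCoord, eval_X, eval_C]
    rw [Finset.sum_congr rfl fun j _ => mul_comm _ _, h1]
    simp
  rw [map_sum, map_mul] at h
  simp only [map_mul] at h
  have hc : restrictHom n (C ((n : ℂ) - 1)) = (n : RationalFunction n) - 1 := by
    rw [map_sub, map_sub, map_natCast, map_natCast, map_one, map_one]
  rw [hc] at h
  exact h

/-- In the invariant coframe, the point of the base has coordinates that are rational functions
of the invariants. -/
lemma coframe_mulVec_xRat {n : ℕ} (hn : 2 ≤ n) : coframe n *ᵥ xRat n =
    (invariantHessian n)⁻¹ *ᵥ (((n : RationalFunction n) - 1) • Pi.single 0 1) := by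
  have h := hessianRat_mulVec_xRat n
  rw [hessianRat_eq hn] at h
  rw [← mulVec_mulVec_eq_smul_single (det_coframe_ne_zero hn) h, mulVec_mulVec,
    nonsing_inv_mul _ (isUnit_det_invariantHessian hn), one_mulVec]

/-- The determinant of the coframe is the inverse of the invariant `I₀₀₂`. -/
lemma invariantHessian_mul_det_coframe {n : ℕ} (hn : 2 ≤ n) :
    invariantHessian n 2 2 * (coframe n).det = 1 := by
  refine apply_two_two_mul_det (det_coframe_ne_zero hn) ?_
  rw [← hessianRat_eq hn]
  exact coframe_two n

/-- The matrix `diag (δ⁻¹, 1, 1)` times the coframe, where `δ` is the determinant of the coframe.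
It has determinant `1`, and moves a jet to one with coframe `diag (δ, 1, 1)`. -/
noncomputable def normalizer : Matrix (Fin 3) (Fin 3) NondegenerateFunction :=
  diagonal ![IsLocalization.Away.invSelf coframePoly.det, 1, 1] *
    coframePoly.map (algebraMap JetPoly NondegenerateFunction)

lemma det_normalizer : normalizer.det = 1 := by
  have h : (coframePoly.map (algebraMap JetPoly NondegenerateFunction)).det =
      algebraMap JetPoly NondegenerateFunction coframePoly.det :=
    ((algebraMap JetPoly NondegenerateFunction).map_det coframePoly).symm
  rw [normalizer, det_mul, det_diagonal, h]
  simp only [Fin.prod_univ_three, cons_val, mul_one]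
  rw [mul_comm]
  exact IsLocalization.Away.mul_invSelf _

lemma normalizer_map_restrictAway {n : ℕ} (hn : 2 ≤ n) :
    normalizer.map (restrictAway hn) =
      diagonal ![((coframe n).det)⁻¹, 1, 1] * coframe n := by
  have h1 : (coframePoly.map (algebraMap JetPoly NondegenerateFunction)).map (restrictAway hn) =
      coframe n := by
    ext1 i j
    exact restrictAway_algebraMap hn _
  have h2 : restrictAway hn (IsLocalization.Away.invSelf coframePoly.det) =
      ((coframe n).det)⁻¹ := by
    have h := congrArg (restrictAway hn)
      (IsLocalization.Away.mul_invSelf (S := NondegenerateFunction) coframePoly.det)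
    rw [map_mul, map_one, restrictAway_algebraMap, restrictHom_det_coframePoly] at h
    exact eq_inv_of_mul_eq_one_right h
  rw [normalizer, Matrix.map_mul, h1, diagonal_map (map_zero _)]
  congr 2
  funext i
  fin_cases i
  · exact h2
  · exact map_one _
  · exact map_one _

/-- The universal jet, moved by the normalizer and then by a constant matrix. -/
noncomputable def normalizedJet (g : Matrix.SpecialLinearGroup (Fin 3) ℂ) :
    JetVar → NondegenerateFunction :=
  move (g.1.map (algebraMap ℂ NondegenerateFunction) * normalizer)
    fun v => algebraMap JetPoly NondegenerateFunction (X v)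

lemma det_map_mul_normalizer (g : Matrix.SpecialLinearGroup (Fin 3) ℂ) :
    (g.1.map (algebraMap ℂ NondegenerateFunction) * normalizer).det = 1 := by
  rw [det_mul, det_normalizer, ← RingHom.mapMatrix_apply, ← RingHom.map_det, g.2, map_one, one_mul]

/-- The values of the normalizer, as elements of the group. -/
noncomputable def normalizerAt (θ : Jet) (h : eval θ coframePoly.det ≠ 0) :
    Matrix.SpecialLinearGroup (Fin 3) ℂ :=
  ⟨normalizer.map (evalAway θ h), by
    rw [← RingHom.mapMatrix_apply, ← RingHom.map_det, det_normalizer, map_one]⟩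

lemma evalAway_constant (θ : Jet) (h : eval θ coframePoly.det ≠ 0) (a : ℂ) :
    evalAway θ h (algebraMap ℂ NondegenerateFunction a) = a := by
  rw [IsScalarTower.algebraMap_apply ℂ JetPoly NondegenerateFunction, evalAway_algebraMap]
  exact eval_C a

lemma restrictAway_constant {n : ℕ} (hn : 2 ≤ n) (a : ℂ) :
    restrictAway hn (algebraMap ℂ NondegenerateFunction a) =
      algebraMap ℂ (RationalFunction n) a := by
  rw [IsScalarTower.algebraMap_apply ℂ JetPoly NondegenerateFunction, restrictAway_algebraMap]
  exact (restrictHom n).commutes a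

lemma evalAway_normalizedJet (g : Matrix.SpecialLinearGroup (Fin 3) ℂ) (θ : Jet)
    (h : eval θ coframePoly.det ≠ 0) (v : JetVar) :
    evalAway θ h (normalizedJet g v) = act (g * normalizerAt θ h) θ v := by
  have h1 : (g.1.map (algebraMap ℂ NondegenerateFunction) * normalizer).map (evalAway θ h) =
      (g * normalizerAt θ h).1 := by
    have h3 : (g.1.map (algebraMap ℂ NondegenerateFunction)).map (evalAway θ h) = g.1 := by
      ext1 i j
      exact evalAway_constant θ h _
    rw [Matrix.map_mul, h3]
    exact (Matrix.SpecialLinearGroup.coe_mul g (normalizerAt θ h)).symm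
  have h2 : (fun v => evalAway θ h (algebraMap JetPoly NondegenerateFunction (X v))) = θ := by
    funext v
    rw [evalAway_algebraMap, eval_X]
  rw [normalizedJet, map_move _ (by rw [det_map_mul_normalizer]; exact isUnit_one), h1, h2,
    act_eq_move]

lemma evalAway_aeval_normalizedJet (g : Matrix.SpecialLinearGroup (Fin 3) ℂ) (θ : Jet)
    (h : eval θ coframePoly.det ≠ 0) (P : JetPoly) :
    evalAway θ h (aeval (normalizedJet g) P) = eval (act (g * normalizerAt θ h) θ) P := by
  induction P using MvPolynomial.induction_on with
  | C a => rw [aeval_C, evalAway_constant, eval_C]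
  | add p q hp hq => rw [map_add, map_add, map_add, hp, hq]
  | mul_X p v hp => rw [map_mul, map_mul, map_mul, hp, aeval_X, evalAway_normalizedJet, eval_X]

/-- The field generated over `ℂ` by the invariants `I_{ijk}`. -/
noncomputable abbrev invariantField (n : ℕ) : IntermediateField ℂ (RationalFunction n) :=
  IntermediateField.adjoin ℂ (Set.range (invariantCoeff n))

lemma invariantCoeff_mem (n : ℕ) (s : MultiIndex) : invariantCoeff n s ∈ invariantField n :=
  IntermediateField.subset_adjoin _ _ ⟨s, rfl⟩

/-- The coordinates of the normalized jet are rational functions of the invariants: its derivatives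
are obtained from the `I_s` by the substitution `(g diag (δ⁻¹, 1, 1))⁻¹`. -/
lemma restrictAway_normalizedJet_mem {n : ℕ} (hn : 2 ≤ n) (g : Matrix.SpecialLinearGroup (Fin 3) ℂ)
    (v : JetVar) : restrictAway hn (normalizedJet g v) ∈ invariantField n := by
  set G : Matrix (Fin 3) (Fin 3) (RationalFunction n) :=
    g.1.map (algebraMap ℂ (RationalFunction n)) * diagonal ![((coframe n).det)⁻¹, 1, 1] with hG
  have hI : ∀ i j, invariantHessian n i j ∈ invariantField n := fun i j => invariantCoeff_mem n _
  have hδ : ((coframe n).det)⁻¹ ∈ invariantField n := by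
    rw [← eq_inv_of_mul_eq_one_left (invariantHessian_mul_det_coframe hn)]
    exact hI 2 2
  have hGm : ∀ i j, G i j ∈ invariantField n := fun i j => by
    rw [hG, mul_diagonal]
    refine mul_mem (IntermediateField.algebraMap_mem _ _) ?_
    fin_cases j
    · exact hδ
    · exact one_mem _
    · exact one_mem _
  have h1 : (g.1.map (algebraMap ℂ NondegenerateFunction) * normalizer).map (restrictAway hn) =
      G * coframe n := by
    rw [Matrix.map_mul, normalizer_map_restrictAway, hG, Matrix.mul_assoc]
    congr 1
    ext1 i j
    exact restrictAway_constant hn _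
  have h2 : ∀ v, restrictAway hn (algebraMap JetPoly NondegenerateFunction (X v)) =
      restrictHom n (X v) := fun v => restrictAway_algebraMap hn _
  rw [normalizedJet, map_move _ (by rw [det_map_mul_normalizer]; exact isUnit_one), h1]
  simp only [h2]
  clear h1 h2
  cases v with
  | inl i =>
    change ((G * coframe n) *ᵥ xRat n) i ∈ _
    rw [← mulVec_mulVec, coframe_mulVec_xRat hn]
    simp only [mulVec, dotProduct]
    refine sum_mem fun j _ => mul_mem (hGm i j) (sum_mem fun k _ => mul_mem ?_ ?_)
    · exact inv_apply_mem _ hI j k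
    · rw [Pi.smul_apply, smul_eq_mul, Pi.single_apply]
      refine mul_mem (sub_mem (natCast_mem _ _) (one_mem _)) ?_
      split_ifs
      · exact one_mem _
      · exact zero_mem _
  | inr s =>
    change substJet (uRat n) (G * coframe n)⁻¹ s ∈ _
    rw [Matrix.mul_inv_rev, ← substJet_substJet]
    exact substJet_mem _ (fun i j => inv_apply_mem _ hGm i j) fun t _ => invariantCoeff_mem n t

lemma restrictAway_aeval_normalizedJet_mem {n : ℕ} (hn : 2 ≤ n)
    (g : Matrix.SpecialLinearGroup (Fin 3) ℂ) (P : JetPoly) :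
    restrictAway hn (aeval (normalizedJet g) P) ∈ invariantField n := by
  induction P using MvPolynomial.induction_on with
  | C a =>
    rw [aeval_C, restrictAway_constant]
    exact IntermediateField.algebraMap_mem _ _
  | add p q hp hq =>
    rw [map_add, map_add]
    exact add_mem hp hq
  | mul_X p v hp =>
    rw [map_mul, map_mul, aeval_X]
    exact mul_mem hp (restrictAway_normalizedJet_mem hn g v)

end Slice

/-! ### The field of invariants -/

/-- An invariant is determined by its values on normalized jets, where all the coordinates are
functions of the `I_{ijk}`. -/
lemma mem_invariantField {n : ℕ} (hn : 2 ≤ n) {f : RationalFunction n}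
    (hf : IsDifferentialInvariant f) : f ∈ invariantField n := by
  obtain ⟨P, Q, hQ, rfl⟩ := exists_eq_div f
  obtain ⟨θ₀, hθ₀, h₀⟩ : ∃ θ ∈ eulerEquation n, eval θ (Q * coframePoly.det) ≠ 0 := by
    by_contra! h
    have h0 := restrictHom_eq_zero_iff.2 h
    rw [map_mul, restrictHom_det_coframePoly] at h0
    exact mul_ne_zero hQ (det_coframe_ne_zero hn) h0
  rw [map_mul] at h₀
  have hδ := right_ne_zero_of_mul h₀
  -- The constant matrix moves the normal form of `θ₀` back to `θ₀`, where `Q` does not vanish.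
  set g := (normalizerAt θ₀ hδ)⁻¹ with hg
  have hq : restrictAway hn (aeval (normalizedJet g) Q) ≠ 0 := by
    intro h
    have h1 := (restrictAway_eq_zero_iff hn _).1 h θ₀ hθ₀ hδ
    rw [evalAway_aeval_normalizedJet, hg, inv_mul_cancel, act_eq_move,
      Matrix.SpecialLinearGroup.coe_one, move_one] at h1
    exact left_ne_zero_of_mul h₀ h1
  have h : restrictAway hn (aeval (normalizedJet g) P * algebraMap JetPoly _ Q -
      algebraMap JetPoly _ P * aeval (normalizedJet g) Q) = 0 := by
    refine (restrictAway_eq_zero_iff hn _).2 fun θ hθ hd => ?_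
    rw [map_sub, map_mul, map_mul, evalAway_algebraMap, evalAway_algebraMap,
      evalAway_aeval_normalizedJet, evalAway_aeval_normalizedJet, sub_eq_zero]
    exact hf (g * normalizerAt θ hd) P Q hQ rfl θ hθ
  rw [map_sub, map_mul, map_mul, restrictAway_algebraMap, restrictAway_algebraMap, sub_eq_zero] at h
  rw [(div_eq_div_iff hQ hq).2 h.symm]
  exact div_mem (restrictAway_aeval_normalizedJet_mem hn g P)
    (restrictAway_aeval_normalizedJet_mem hn g Q)

lemma isDifferentialInvariant_of_mem {n : ℕ} (hn : 2 ≤ n) {f : RationalFunction n}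
    (hf : f ∈ invariantField n) : IsDifferentialInvariant f := by
  refine isDifferentialInvariant_iff.2 fun A => ?_
  induction hf using IntermediateField.adjoin_induction with
  | mem x hx =>
    obtain ⟨s, rfl⟩ := hx
    exact actRat_invariantCoeff hn A s
  | algebraMap x => exact (actRat n A).commutes x
  | add x y _ _ hx hy => rw [map_add, hx, hy]
  | inv x _ hx => rw [map_inv₀, hx]
  | mul x y _ _ hx hy => rw [map_mul, hx, hy]

end TernaryJets

theorem mainTheorem6 (n : ℕ) (hn : 2 ≤ n) :
    -- the construction makes sense: `A` and `ω₁ ∧ ω₂ ∧ ω₃` do not vanish identically, and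
    -- `ω₃` is orthogonal to `ω₁` and `ω₂`
    restrict n hessian.det ≠ 0 ∧ (coframe n).det ≠ 0 ∧
    coframe n 0 ⬝ᵥ (theta2Inv n).mulVec (coframe n 2) = 0 ∧
    coframe n 1 ⬝ᵥ (theta2Inv n).mulVec (coframe n 2) = 0 ∧
    -- the coefficients `I_σ` of the tensors `Θ_m` in this coframe exist and are unique
    ∃ I : MultiIndex → RationalFunction n, (∀ J, IsExpansion n J ↔ J = I) ∧
      -- they are invariants of order `|σ|` (of order `3` if `|σ| = 2`)
      (∀ s, IsDifferentialInvariant (I s) ∧ I s ∈ orderLE n (if s.degree = 2 then 3 else s.degree)) ∧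
      -- the rational differential invariants are exactly the rational functions of them
      (∀ f : RationalFunction n,
        IsDifferentialInvariant f ↔ f ∈ IntermediateField.adjoin ℂ (Set.range I)) := by
  refine ⟨restrictHom_det_hessian_ne_zero hn, det_coframe_ne_zero hn, ?_, ?_, invariantCoeff n,
    isExpansion_iff hn, fun s => ⟨isDifferentialInvariant_iff.2 fun A => actRat_invariantCoeff hn A s,
      invariantCoeff_mem_orderLE hn s⟩,
    fun f => ⟨mem_invariantField hn, isDifferentialInvariant_of_mem hn⟩⟩
  · rw [theta2Inv_mulVec_coframe_two hn, dotProduct_smul, dot_self_cross, smul_zero]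
  · rw [theta2Inv_mulVec_coframe_two hn, dotProduct_smul, dot_cross_self, smul_zero]
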